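/- Let $\beta\ge 0$. Let $Q^{(\beta)}=(Q^{(\beta)}_t)_{t\ge0}$ be the Feller semigroup on $C_0([0,\infty))$ of the (scaled) squared Bessel process of index $\beta-1$, i.e. the unique Feller semigroup whose generator acts on $C_c^\infty([0,\infty))$ as $x\,\partial^2+\beta\,\partial$, and let $\mathbb Q^{(\beta)}=(\mathbb Q^{(\beta)}_t)_{t\ge0}$ be the Feller semigroup on $c_0(\mathbb Z_+)$ of the linear birth–death process with birth rates $n+\beta$ and death rates $n$, i.e. the unique Feller semigroup whose generator acts on finitely supported functions as $(n+\beta)\partial_++n\,\partial_-$, where $\partial_\pm g(n)=g(n\pm1)-g(n)$ (Feller semigroups are understood to be conservative). For $g\in c_0(\mathbb Z_+)$ let $\Lambda g(x)=\mathbb E[g(\mathrm{Pois}(x))]$, $x\ge0$, where $\mathrm{Pois}(x)$ is a Poisson variable of parameter $x$; for $\sigma\in(0,1]$ let $\mathbb D_\sigma g(n)=\sum_{m=0}^n\binom nm\sigma^m(1-\sigma)^{n-m}g(m)$, and let $d_\sigma f(x)=f(\sigma x)$. For $t\ge0$ put $$K^{(\beta)}_t=Q^{(\beta)}_{e^t-1}\,d_{e^{-t}}\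 \text{ on } C_0([0,\infty)),\qquad \mathbb K^{(\beta)}_t=\mathbb Q^{(\beta)}_{e^t-1}\,\mathbb D_{e^{-t}}\ \text{ on } c_0(\mathbb Z_+).$$ Then $(\mathbb K^{(\beta)}_t)_{t\ge0}$ is the Feller semigroup on $c_0(\mathbb Z_+)$ of a birth–death chain on $\mathbb Z_+$, namely of the one with birth rates $n+\beta$ and death rates $2n$: it is a Feller semigroup whose generator acts on finitely supported functions as $(n+\beta)\partial_++2n\,\partial_-$. Moreover, for every $t\ge0$, $$K^{(\beta)}_t\,\Lambda=\Lambda\,\mathbb K^{(\beta)}_t\quad\text{on } c_0(\mathbb Z_+).$$ -/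

import Mathlib

noncomputable section

namespace Gateway

open Filter Topology
open scoped NNReal ZeroAtInfty ContDiff

/-! ### Feller semigroups and their generators -/

/-- A (conservative) Feller semigroup on `C₀(E)`: a strongly continuous semigroup of positive
contractions which is Markovian. As the constant function `1` need not belong to `C₀(E)`, the
Markov property `T t 1 = 1` is expressed by saying that the total mass
`sup {T t f x | f ∈ C₀(E), 0 ≤ f ≤ 1}` of the transition probability from `x` is `1`. -/
structure IsFellerSemigroup {E : Type*} [TopologicalSpace E]
    (T : ℝ≥0 → C₀(E, ℝ) →L[ℝ] C₀(E, ℝ)) : Prop where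
  zero : T 0 = ContinuousLinearMap.id ℝ C₀(E, ℝ)
  add : ∀ s t : ℝ≥0, T (s + t) = (T s).comp (T t)
  nonneg : ∀ (t : ℝ≥0) (f : C₀(E, ℝ)), (∀ x, 0 ≤ f x) → ∀ x, 0 ≤ T t f x
  contraction : ∀ t : ℝ≥0, ‖T t‖ ≤ 1
  markov : ∀ (t : ℝ≥0) (x : E),
    IsLUB {r : ℝ | ∃ f : C₀(E, ℝ), (∀ y, 0 ≤ f y) ∧ (∀ y, f y ≤ 1) ∧ T t f x = r} 1
  tendsto_zero : ∀ f : C₀(E, ℝ), Tendsto (fun t : ℝ≥0 => T t f) (𝓝 0) (𝓝 f)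

/-- `f` belongs to the domain of the infinitesimal generator of `T`, and the generator maps
`f` to the function `h`: the difference quotients `(T t f - f) / t` converge uniformly to `h`
as `t` decreases to `0`, and `h` is in `C₀(E)`. -/
def GeneratorMapsTo {E : Type*} [TopologicalSpace E]
    (T : ℝ≥0 → C₀(E, ℝ) →L[ℝ] C₀(E, ℝ)) (f : C₀(E, ℝ)) (h : E → ℝ) : Prop :=
  ∃ g : C₀(E, ℝ), (∀ x, g x = h x) ∧
    Tendsto (fun t : ℝ≥0 => (t : ℝ)⁻¹ • (T t f - f)) (𝓝[>] 0) (𝓝 g)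

/-! ### Birth–death chains on `ℤ₊` -/

/-- The difference operator `b(n) ∂₊ + d(n) ∂₋`, where `∂± f(n) = f(n ± 1) - f(n)`, with birth
rates `b` and death rates `d`. At `n = 0` the second term vanishes. -/
def birthDeathOperator (b d : ℕ → ℝ) (f : ℕ → ℝ) (n : ℕ) : ℝ :=
  b n * (f (n + 1) - f n) + d n * (f (n - 1) - f n)

/-- `T` is the Feller semigroup on `c₀(ℤ₊)` of a birth–death chain with birth rates `b` and
death rates `d`: its generator is given on the finitely supported functions by the tridiagonal
rate matrix of the chain. -/
structure IsBirthDeathSemigroup (b d : ℕ → ℝ) (T : ℝ≥0 → C₀(ℕ, ℝ) →L[ℝ] C₀(ℕ, ℝ)) : Prop where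
  birth_nonneg : ∀ n, 0 ≤ b n
  death_nonneg : ∀ n, 0 ≤ d n
  death_zero : d 0 = 0
  feller : IsFellerSemigroup T
  generator : ∀ f : C₀(ℕ, ℝ), (Function.support f).Finite →
    GeneratorMapsTo T f (birthDeathOperator b d f)

open Classical in
/-- The Feller semigroup of the linear birth–death process, with generator
`(n + β) ∂₊ + n ∂₋`: the unique birth–death semigroup with these rates. -/
def discreteBessel (β : ℝ) : ℝ≥0 → C₀(ℕ, ℝ) →L[ℝ] C₀(ℕ, ℝ) :=
  if h : ∃! T, IsBirthDeathSemigroup (fun n => n + β) (fun n => n) T then h.choose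
  else fun _ => 0

/-! ### The squared Bessel semigroup -/

/-- `T` is a Feller semigroup on `C₀([0, ∞))` whose generator acts on `C_c^∞([0, ∞))` (smooth up
to the boundary point `0`, which it does not have to avoid) as `x ∂² + β ∂`. -/
structure IsSquaredBesselSemigroup (β : ℝ) (T : ℝ≥0 → C₀(ℝ≥0, ℝ) →L[ℝ] C₀(ℝ≥0, ℝ)) :
    Prop where
  feller : IsFellerSemigroup T
  generator : ∀ (F : ℝ → ℝ) (f : C₀(ℝ≥0, ℝ)), ContDiff ℝ ∞ F → HasCompactSupport F →
    (∀ x : ℝ≥0, f x = F x) →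
    GeneratorMapsTo T f (fun x => x * deriv (deriv F) x + β * deriv F x)

open Classical in
/-- The Feller semigroup of the (scaled) squared Bessel process of index `β - 1`, with generator
`x ∂² + β ∂`: the unique semigroup as above. -/
def squaredBessel (β : ℝ) : ℝ≥0 → C₀(ℝ≥0, ℝ) →L[ℝ] C₀(ℝ≥0, ℝ) :=
  if h : ∃! T, IsSquaredBesselSemigroup β T then h.choose else fun _ => 0

/-! ### Operators given by Markov kernels with values in `ℤ₊` -/

/-- A Markov kernel from `X` to `ℤ₊` mapping indicators of points into `C₀(X)`. -/
structure IsC0MarkovKernel {X : Type*} [TopologicalSpace X] (p : X → ℕ → ℝ) : Prop where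
  nonneg : ∀ x m, 0 ≤ p x m
  hasSum_one : ∀ x, HasSum (p x) 1
  continuous : ∀ m, Continuous fun x => p x m
  tendsto_zero : ∀ m, Tendsto (fun x => p x m) (cocompact X) (𝓝 0)

section kernel

variable {X : Type*} [TopologicalSpace X] {p : X → ℕ → ℝ}

theorem abs_apply_le_norm {Y : Type*} [TopologicalSpace Y] (f : C₀(Y, ℝ)) (y : Y) :
    |f y| ≤ ‖f‖ := by
  have h := f.toBCF.norm_coe_le_norm y
  simpa using h

theorem IsC0MarkovKernel.summable_of_le (hp : IsC0MarkovKernel p) {g : ℕ → ℝ} {C : ℝ}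
    (hg : ∀ m, |g m| ≤ C) (x : X) : Summable fun m => p x m * g m := by
  refine Summable.of_norm_bounded ((hp.hasSum_one x).summable.mul_right C) fun m => ?_
  rw [norm_mul, Real.norm_of_nonneg (hp.nonneg x m), Real.norm_eq_abs]
  exact mul_le_mul_of_nonneg_left (hg m) (hp.nonneg x m)

theorem IsC0MarkovKernel.abs_tsum_le (hp : IsC0MarkovKernel p) {g : ℕ → ℝ} {C : ℝ}
    (hg : ∀ m, |g m| ≤ C) (x : X) : |∑' m, p x m * g m| ≤ C := by
  have h1 : HasSum (fun m => p x m * C) C := by simpa using (hp.hasSum_one x).mul_right C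
  rw [← Real.norm_eq_abs]
  refine tsum_of_norm_bounded h1 fun m => ?_
  rw [norm_mul, Real.norm_of_nonneg (hp.nonneg x m), Real.norm_eq_abs]
  exact mul_le_mul_of_nonneg_left (hg m) (hp.nonneg x m)

theorem IsC0MarkovKernel.tendstoUniformly (hp : IsC0MarkovKernel p) (f : C₀(ℕ, ℝ)) :
    TendstoUniformly (fun (N : ℕ) x => ∑ m ∈ Finset.range N, p x m * f m)
      (fun x => ∑' m, p x m * f m) atTop := by
  rw [Metric.tendstoUniformly_iff]
  intro ε hε
  have hf : Tendsto f atTop (𝓝 0) := by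
    have := f.zero_at_infty'
    rwa [cocompact_eq_cofinite, Nat.cofinite_eq_atTop] at this
  obtain ⟨N, hN⟩ := Metric.tendsto_atTop.1 hf (ε / 2) (by positivity)
  filter_upwards [eventually_ge_atTop N] with M hM x
  have hs : Summable fun m => p x m * f m := hp.summable_of_le (abs_apply_le_norm f) x
  set g : ℕ → ℝ := fun m => if m ∈ Finset.range M then 0 else f m with hg
  have hgle : ∀ m, |g m| ≤ ε / 2 := by
    intro m
    by_cases hm : m < M
    · simp [hg, hm]; positivity
    · have := hN m (by omega)
      rw [Real.dist_eq, sub_zero] at this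
      simp [hg, hm, this.le]
  have h2 : ∑' m, p x m * f m - ∑ m ∈ Finset.range M, p x m * f m = ∑' m, p x m * g m := by
    have hfin : ∑ m ∈ Finset.range M, p x m * f m
        = ∑' m, (if m ∈ Finset.range M then p x m * f m else 0) := by
      rw [tsum_eq_sum (s := Finset.range M)]
      · exact Finset.sum_congr rfl fun m hm => by rw [if_pos hm]
      · intro m hm; rw [if_neg hm]
    rw [hfin, ← hs.tsum_sub]
    · refine tsum_congr fun m => ?_
      by_cases hm : m ∈ Finset.range M <;> simp only [hg, hm, if_true, if_false] <;> ring
    · exact summable_of_ne_finset_zero (s := Finset.range M) fun m hm => by rw [if_neg hm]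
  rw [Real.dist_eq, h2]
  exact (hp.abs_tsum_le hgle x).trans_lt (by linarith)

/-- The operator `f ↦ (x ↦ ∑ₘ p(x, m) f(m))` from `c₀(ℤ₊)` to `C₀(X)`. -/
def kernelOperator (p : X → ℕ → ℝ) (hp : IsC0MarkovKernel p) : C₀(ℕ, ℝ) →L[ℝ] C₀(X, ℝ) :=
  LinearMap.mkContinuous
    { toFun := fun f =>
        { toFun := fun x => ∑' m, p x m * f m
          continuous_toFun := (hp.tendstoUniformly f).continuous
            (Frequently.of_forall fun N => continuous_finsetSum _ fun m _ =>
              (hp.continuous m).mul continuous_const)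
          zero_at_infty' := by
            refine (hp.tendstoUniformly f).tendstoUniformlyOnFilter.mono_right le_top
              |>.tendsto_of_eventually_tendsto (L := fun _ => 0)
              (Eventually.of_forall fun N => ?_) tendsto_const_nhds
            simpa using tendsto_finsetSum (Finset.range N) fun m _ =>
              (hp.tendsto_zero m).mul_const (f m) }
      map_add' := fun f g => by
        ext x
        change ∑' m, p x m * (f m + g m) = ∑' m, p x m * f m + ∑' m, p x m * g m
        rw [← (hp.summable_of_le (abs_apply_le_norm f) x).tsum_add
          (hp.summable_of_le (abs_apply_le_norm g) x)]
        exact tsum_congr fun m => mul_add _ _ _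
      map_smul' := fun c f => by
        ext x
        change ∑' m, p x m * (c * f m) = c * ∑' m, p x m * f m
        rw [← tsum_mul_left]
        exact tsum_congr fun m => by ring } 1
    (fun f => by
      rw [one_mul]
      refine (BoundedContinuousFunction.norm_le (norm_nonneg f)).2 fun x => ?_
      rw [Real.norm_eq_abs]
      exact hp.abs_tsum_le (abs_apply_le_norm f) x)

end kernel

/-! ### The Poisson kernel -/

/-- The probability that a Poisson variable of parameter `x` equals `m`. -/
def poissonKernel (x : ℝ≥0) (m : ℕ) : ℝ := Real.exp (-x) * (x : ℝ) ^ m / m.factorial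

theorem isC0MarkovKernel_poissonKernel : IsC0MarkovKernel poissonKernel where
  nonneg x m := by unfold poissonKernel; positivity
  hasSum_one x := by
    have h := (NormedSpace.expSeries_div_hasSum_exp (x : ℝ)).mul_left (Real.exp (-x))
    rw [← Real.exp_eq_exp_ℝ, ← Real.exp_add, neg_add_cancel, Real.exp_zero] at h
    refine h.congr_fun ?_ |> fun h => h
    intro m
    simp only [poissonKernel, mul_div_assoc]
  continuous m := by unfold poissonKernel; fun_prop
  tendsto_zero m := by
    have h1 := (Real.tendsto_pow_mul_exp_neg_atTop_nhds_zero m).div_const (m.factorial : ℝ)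
    rw [zero_div] at h1
    have h2 : Tendsto (fun x : ℝ≥0 => (x : ℝ)) (cocompact ℝ≥0) atTop := by
      rw [cocompact_eq_atTop]
      exact NNReal.tendsto_coe_atTop.2 tendsto_id
    refine (h1.comp h2).congr fun x => ?_
    simp only [poissonKernel, Function.comp_apply, mul_comm]

/-- The operator `Λ g (x) = 𝔼[g(Pois(x))]` from `c₀(ℤ₊)` to `C₀([0, ∞))`. -/
def poissonOperator : C₀(ℕ, ℝ) →L[ℝ] C₀(ℝ≥0, ℝ) :=
  kernelOperator poissonKernel isC0MarkovKernel_poissonKernel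

theorem poissonOperator_apply (g : C₀(ℕ, ℝ)) (x : ℝ≥0) :
    poissonOperator g x = ∑' m : ℕ, Real.exp (-x) * (x : ℝ) ^ m / m.factorial * g m := rfl

/-! ### Dilations -/

/-- The binomial kernel `𝔻_σ(n, m) = C(n, m) σ^m (1 - σ)^(n - m)`, zero for `m > n`. -/
def binomialKernel (σ : ℝ) (n m : ℕ) : ℝ := n.choose m * σ ^ m * (1 - σ) ^ (n - m)

theorem isC0MarkovKernel_binomialKernel {σ : ℝ} (h0 : 0 < σ) (h1 : σ ≤ 1) :
    IsC0MarkovKernel (binomialKernel σ) where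
  nonneg n m := by
    have : 0 ≤ 1 - σ := by linarith
    unfold binomialKernel; positivity
  hasSum_one n := by
    have h := add_pow σ (1 - σ) n
    rw [add_sub_cancel, one_pow] at h
    rw [h]
    have : ∑ m ∈ Finset.range (n + 1), σ ^ m * (1 - σ) ^ (n - m) * (n.choose m : ℝ)
        = ∑ m ∈ Finset.range (n + 1), binomialKernel σ n m :=
      Finset.sum_congr rfl fun m _ => by unfold binomialKernel; ring
    rw [this]
    refine hasSum_sum_of_ne_finset_zero fun m hm => ?_
    have : n < m := by simpa using hm
    simp [binomialKernel, Nat.choose_eq_zero_of_lt this]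
  continuous m := continuous_of_discreteTopology
  tendsto_zero m := by
    rw [cocompact_eq_cofinite, Nat.cofinite_eq_atTop, ← tendsto_add_atTop_iff_nat m]
    have hq : |1 - σ| < 1 := by rw [abs_lt]; constructor <;> linarith
    have hnn : 0 ≤ 1 - σ := by linarith
    have hlim : Tendsto (fun k : ℕ => ((k + m : ℕ) : ℝ) ^ m * (1 - σ) ^ k) atTop (𝓝 0) := by
      have hb : Tendsto (fun k : ℕ => (2 ^ m : ℝ) * ((k : ℝ) ^ m * (1 - σ) ^ k)) atTop (𝓝 0) := by
        simpa using (tendsto_pow_const_mul_const_pow_of_abs_lt_one m hq).const_mul (2 ^ m : ℝ)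
      refine squeeze_zero' (Eventually.of_forall fun k => by positivity) ?_ hb
      filter_upwards [eventually_ge_atTop m] with k hk
      have hkm : ((k + m : ℕ) : ℝ) ≤ 2 * k := by
        have : ((m : ℕ) : ℝ) ≤ k := by exact_mod_cast hk
        push_cast; linarith
      rw [← mul_assoc, ← mul_pow]
      gcongr
    refine squeeze_zero (fun k => by unfold binomialKernel; positivity) (fun k => ?_) hlim
    unfold binomialKernel
    rw [Nat.add_sub_cancel]
    have hc : ((k + m).choose m : ℝ) ≤ ((k + m : ℕ) : ℝ) ^ m := by
      exact_mod_cast Nat.choose_le_pow (k + m) m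
    have hs : σ ^ m ≤ 1 := pow_le_one₀ h0.le h1
    calc ((k + m).choose m : ℝ) * σ ^ m * (1 - σ) ^ k
        ≤ ((k + m : ℕ) : ℝ) ^ m * 1 * (1 - σ) ^ k := by gcongr
      _ = ((k + m : ℕ) : ℝ) ^ m * (1 - σ) ^ k := by rw [mul_one]

/-- The discrete dilation `𝔻_σ f (n) = ∑_{m ≤ n} f(m) 𝔻_σ(n, m)` on `c₀(ℤ₊)`, `0 < σ ≤ 1`. -/
def discreteDilation (σ : ℝ) (h0 : 0 < σ) (h1 : σ ≤ 1) : C₀(ℕ, ℝ) →L[ℝ] C₀(ℕ, ℝ) :=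
  kernelOperator (binomialKernel σ) (isC0MarkovKernel_binomialKernel h0 h1)

theorem discreteDilation_apply (σ : ℝ) (h0 : 0 < σ) (h1 : σ ≤ 1) (f : C₀(ℕ, ℝ)) (n : ℕ) :
    discreteDilation σ h0 h1 f n
      = ∑ m ∈ Finset.range (n + 1), f m * (n.choose m * σ ^ m * (1 - σ) ^ (n - m)) := by
  change ∑' m, binomialKernel σ n m * f m = _
  rw [tsum_eq_sum (s := Finset.range (n + 1))]
  · exact Finset.sum_congr rfl fun m _ => mul_comm _ _
  · intro m hm
    have : n < m := by simpa using hm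
    simp [binomialKernel, Nat.choose_eq_zero_of_lt this]

/-- The dilation `d_σ f (x) = f (σ x)` on `C₀([0, ∞))`, `σ > 0`. -/
def dilation (σ : ℝ≥0) (h0 : 0 < σ) : C₀(ℝ≥0, ℝ) →L[ℝ] C₀(ℝ≥0, ℝ) :=
  LinearMap.mkContinuous
    { toFun := fun f =>
        { toFun := fun x => f (σ * x)
          continuous_toFun := f.continuous.comp (continuous_const.mul continuous_id)
          zero_at_infty' := f.zero_at_infty'.comp
            (Homeomorph.mulLeft₀ σ h0.ne').isClosedEmbedding.tendsto_cocompact }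
      map_add' := fun _ _ => rfl
      map_smul' := fun _ _ => rfl } 1
    (fun f => by
      rw [one_mul]
      refine (BoundedContinuousFunction.norm_le (norm_nonneg f)).2 fun x => ?_
      exact abs_apply_le_norm f (σ * x))

theorem dilation_apply (σ : ℝ≥0) (h0 : 0 < σ) (f : C₀(ℝ≥0, ℝ)) (x : ℝ≥0) :
    dilation σ h0 f x = f (σ * x) := rfl

/-! ### The Laguerre semigroups -/

/-- The continuous Laguerre semigroup `K_t = Q_{e^t - 1} d_{e^{-t}}` on `C₀([0, ∞))`. -/
def continuousLaguerre (β : ℝ) (t : ℝ≥0) : C₀(ℝ≥0, ℝ) →L[ℝ] C₀(ℝ≥0, ℝ) :=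
  (squaredBessel β (Real.exp t - 1).toNNReal).comp
    (dilation (Real.exp (-t)).toNNReal (Real.toNNReal_pos.2 (Real.exp_pos _)))

/-- The discrete Laguerre semigroup `𝕂_t = ℚ_{e^t - 1} 𝔻_{e^{-t}}` on `c₀(ℤ₊)`. -/
def discreteLaguerre (β : ℝ) (t : ℝ≥0) : C₀(ℕ, ℝ) →L[ℝ] C₀(ℕ, ℝ) :=
  (discreteBessel β (Real.exp t - 1).toNNReal).comp
    (discreteDilation (Real.exp (-t)) (Real.exp_pos _)
      (Real.exp_le_one_iff.2 (neg_nonpos.2 t.2)))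

end Gateway

end

/-! Write `e_w` for the exponential `x ↦ exp (-w x)` on `[0, ∞)`, respectively `n ↦ (1 - w) ^ n`
on `ℤ₊`. Both Bessel generators act on these families as the first order operator `-β w - w² ∂_w`,
so both semigroups should satisfy `T t e_w = (1 + t w) ^ (-β) • e_{w / (1 + t w)}`. In either case
such a semigroup is obtained from an explicit random experiment: a gamma variable with Poisson
distributed shape on `[0, ∞)`, and pure birth followed by binomial thinning on `ℤ₊`. It is the only
semigroup with the given generator, because the `e_w` are limits in the graph norm of functions in
the core, which determines the generator on them, and the Cauchy problem started from `e_w` has a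
unique solution. Since `Λ` and the dilations also map exponentials to exponentials, the intertwining
relation, the semigroup property of `𝕂` and its generator can all be read off from the parameters.
-/

noncomputable section

namespace Gateway

open Filter Topology
open scoped NNReal ZeroAtInfty ContDiff

/-! ### Contraction semigroups and their generators -/

section Semigroup

variable {V W : Type*} [NormedAddCommGroup V] [NormedSpace ℝ V] [NormedAddCommGroup W]
  [NormedSpace ℝ W] {T : ℝ≥0 → V →L[ℝ] V}

/-- `f` belongs to the domain of the generator of `T`, which maps it to `g`: the abstract form of
`GeneratorMapsTo`, for operators on a normed space. -/
def HasGenerator (T : ℝ≥0 → V →L[ℝ] V) (f g : V) : Prop :=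
  Tendsto (fun t : ℝ≥0 => (t : ℝ)⁻¹ • (T t f - f)) (𝓝[>] 0) (𝓝 g)

/-- A strongly continuous semigroup of contractions of a normed space. -/
structure IsContractionSemigroup (T : ℝ≥0 → V →L[ℝ] V) : Prop where
  zero : T 0 = ContinuousLinearMap.id ℝ V
  add : ∀ s t : ℝ≥0, T (s + t) = (T s).comp (T t)
  contraction : ∀ t : ℝ≥0, ‖T t‖ ≤ 1
  tendsto_zero : ∀ f : V, Tendsto (fun t : ℝ≥0 => T t f) (𝓝 0) (𝓝 f)

theorem norm_apply_le_of_norm_le_one {A : V →L[ℝ] W} (hA : ‖A‖ ≤ 1) (f : V) : ‖A f‖ ≤ ‖f‖ := by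
  simpa using A.le_of_opNorm_le hA f

theorem tendsto_apply_of_dense_span {ι : Type*} {l : Filter ι} {A : ι → V →L[ℝ] W}
    {B : V →L[ℝ] W} (hA : ∀ i, ‖A i‖ ≤ 1) {S : Set V}
    (hS : Dense (Submodule.span ℝ S : Set V))
    (h : ∀ f ∈ S, Tendsto (fun i => A i f) l (𝓝 (B f))) (f : V) :
    Tendsto (fun i => A i f) l (𝓝 (B f)) := by
  have hequi : Equicontinuous fun i => (A i : V → W) :=
    (LipschitzWith.uniformEquicontinuous _ 1 fun i =>
      (A i).lipschitz.weaken (hA i)).equicontinuous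
  have hspan : ∀ f ∈ Submodule.span ℝ S, Tendsto (fun i => A i f) l (𝓝 (B f)) := by
    intro f hf
    induction hf using Submodule.span_induction with
    | mem f hf => exact h f hf
    | zero => simpa using tendsto_const_nhds
    | add f g _ _ hf hg => simpa using hf.add hg
    | smul c f _ hf => simpa using hf.const_smul c
  exact (hequi.isClosed_setOfPred_tendsto B.continuous).closure_subset_iff.2 hspan (hS f)

theorem hasGenerator_iff_hasDerivWithinAt {f g : V} (h0 : T 0 f = f) :
    HasGenerator T f g ↔
      HasDerivWithinAt (fun r : ℝ => T r.toNNReal f) g (Set.Ici 0) 0 := by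
  rw [hasDerivWithinAt_iff_tendsto_slope, Set.Ici_sdiff_left, ← NNReal.coe_zero,
    ← NNReal.map_coe_nhdsGT, tendsto_map'_iff, HasGenerator]
  refine tendsto_congr fun t => ?_
  simp [slope_def_module, h0]

theorem HasGenerator.add {f f' g g' : V} (h : HasGenerator T f g)
    (h' : HasGenerator T f' g') : HasGenerator T (f + f') (g + g') := by
  refine (Tendsto.add h h').congr fun t => ?_
  rw [← smul_add, map_add]
  congr 1
  abel

theorem HasGenerator.smul {f g : V} (h : HasGenerator T f g) (c : ℝ) :
    HasGenerator T (c • f) (c • g) := by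
  refine (Tendsto.const_smul h c).congr fun t => ?_
  rw [map_smul, ← smul_sub, smul_comm]

theorem HasGenerator.sum {ι : Type*} {f g : ι → V} (s : Finset ι)
    (h : ∀ i ∈ s, HasGenerator T (f i) (g i)) :
    HasGenerator T (∑ i ∈ s, f i) (∑ i ∈ s, g i) := by
  classical
  induction s using Finset.induction_on with
  | empty => simp [HasGenerator]
  | insert a s ha ih =>
    rw [Finset.sum_insert ha, Finset.sum_insert ha]
    exact (h a (Finset.mem_insert_self a s)).add
      (ih fun i hi => h i (Finset.mem_insert_of_mem hi))

theorem HasGenerator.tendsto {f g : V} (h : HasGenerator T f g) (h0 : T 0 f = f) :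
    Tendsto (fun t : ℝ≥0 => T t f) (𝓝 0) (𝓝 f) := by
  have hright := ((hasGenerator_iff_hasDerivWithinAt h0).1 h).continuousWithinAt.tendsto
  rw [← NNReal.coe_zero, ← NNReal.map_coe_nhdsGE, tendsto_map'_iff] at hright
  have huniv : Set.Ici (0 : ℝ≥0) = Set.univ := Set.Ici_bot
  simpa [Function.comp_def, h0, huniv] using hright

namespace IsContractionSemigroup

theorem norm_apply_le (hT : IsContractionSemigroup T) (t : ℝ≥0) (f : V) : ‖T t f‖ ≤ ‖f‖ :=
  norm_apply_le_of_norm_le_one (hT.contraction t) f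

theorem dist_apply_le (hT : IsContractionSemigroup T) (t : ℝ≥0) (f g : V) :
    dist (T t f) (T t g) ≤ dist f g := by
  rw [dist_eq_norm, dist_eq_norm, ← map_sub]
  exact hT.norm_apply_le t _

theorem dist_apply_apply_le (hT : IsContractionSemigroup T) (f : V) (s t : ℝ≥0) :
    dist (T s f) (T t f) ≤ dist (T (nndist s t) f) f := by
  wlog hst : t ≤ s generalizing s t
  · rw [dist_comm, nndist_comm]
    exact this t s (le_of_not_ge hst)
  have hdist : nndist s t = s - t := by
    rw [NNReal.nndist_eq, tsub_eq_zero_of_le hst, max_eq_left zero_le]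
  have hsplit : T s f = T t (T (s - t) f) := by
    rw [← ContinuousLinearMap.comp_apply, ← hT.add, add_tsub_cancel_of_le hst]
  rw [hdist, hsplit]
  exact hT.dist_apply_le t _ _

theorem continuous_uncurry (hT : IsContractionSemigroup T) :
    Continuous fun p : ℝ≥0 × V => T p.1 p.2 := by
  rw [continuous_iff_continuousAt]
  rintro ⟨t, f⟩
  rw [ContinuousAt, tendsto_iff_dist_tendsto_zero]
  refine squeeze_zero (g := fun p : ℝ≥0 × V => dist p.2 f + dist (T (nndist p.1 t) f) f)
    (fun _ => dist_nonneg) (fun p => ?_) ?_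
  · exact (dist_triangle _ (T p.1 f) _).trans
      (add_le_add (hT.dist_apply_le _ _ _) (hT.dist_apply_apply_le _ _ _))
  · have hfst : Tendsto (fun p : ℝ≥0 × V => nndist p.1 t) (𝓝 (t, f)) (𝓝 0) :=
      Continuous.tendsto' (by fun_prop) _ _ (nndist_self t)
    have hsnd : Tendsto (fun p : ℝ≥0 × V => dist p.2 f) (𝓝 (t, f)) (𝓝 0) :=
      Continuous.tendsto' (by fun_prop) _ _ (dist_self f)
    simpa using hsnd.add (((hT.tendsto_zero f).comp hfst).dist (tendsto_const_nhds (x := f)))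

theorem continuous_toNNReal_apply (hT : IsContractionSemigroup T) (f : V) :
    Continuous fun r : ℝ => T r.toNNReal f :=
  hT.continuous_uncurry.comp (f := fun r : ℝ => (r.toNNReal, f)) (by fun_prop)

theorem hasDerivWithinAt (hT : IsContractionSemigroup T) {f g : V} (h : HasGenerator T f g)
    {s : ℝ} (hs : 0 ≤ s) :
    HasDerivWithinAt (fun r : ℝ => T r.toNNReal f) (T s.toNNReal g) (Set.Ici s) s := by
  have h0 : HasDerivWithinAt (fun r : ℝ => T r.toNNReal f) g (Set.Ici (s - s)) (s - s) := by
    rw [sub_self]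
    exact (hasGenerator_iff_hasDerivWithinAt (by simp [hT.zero])).1 h
  have hshift := h0.scomp (h := fun r => r - s) s
    ((hasDerivAt_id' s).sub_const s).hasDerivWithinAt fun r (hr : s ≤ r) => sub_le_sub_right hr s
  rw [one_smul] at hshift
  refine ((T s.toNNReal).hasFDerivAt.comp_hasDerivWithinAt s hshift).congr_of_mem
    (fun r hr => ?_) Set.self_mem_Ici
  have hadd : r.toNNReal = s.toNNReal + (r - s).toNNReal := by
    rw [← Real.toNNReal_add hs (sub_nonneg.2 hr), add_sub_cancel]
  simp [hadd, hT.add]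

theorem hasGenerator_iff_integral_eq [CompleteSpace V] (hT : IsContractionSemigroup T)
    {f g : V} :
    HasGenerator T f g ↔ ∀ t : ℝ≥0, ∫ r in (0 : ℝ)..t, T r.toNNReal g = T t f - f := by
  have hcont := hT.continuous_toNNReal_apply
  have h0 : T 0 f = f := by simp [hT.zero]
  constructor
  · intro h t
    have hder : ∀ r ∈ Set.Ioo (0 : ℝ) t,
        HasDerivWithinAt (fun r : ℝ => T r.toNNReal f) (T r.toNNReal g) (Set.Ioi r) r :=
      fun r hr => (hT.hasDerivWithinAt h hr.1.le).mono Set.Ioi_subset_Ici_self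
    simpa [h0] using intervalIntegral.integral_eq_sub_of_hasDeriv_right_of_le t.2
      (hcont f).continuousOn hder ((hcont g).intervalIntegrable _ _)
  · intro h
    have hder : HasDerivAt (fun t : ℝ => ∫ r in (0 : ℝ)..t, T r.toNNReal g) g 0 := by
      simpa [hT.zero] using (hcont g).integral_hasStrictDerivAt 0 0 |>.hasDerivAt
    rw [hasGenerator_iff_hasDerivWithinAt h0]
    refine (hder.hasDerivWithinAt.add_const f).congr_of_mem (fun t ht => ?_) Set.self_mem_Ici
    have := h t.toNNReal
    rw [Real.coe_toNNReal t ht] at this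
    rw [this, sub_add_cancel]

theorem isClosed_setOf_hasGenerator [CompleteSpace V] (hT : IsContractionSemigroup T) :
    IsClosed {p : V × V | HasGenerator T p.1 p.2} := by
  simp only [hT.hasGenerator_iff_integral_eq, Set.ofPred_forall]
  refine isClosed_iInter fun t => isClosed_eq ?_ (by fun_prop)
  refine intervalIntegral.continuous_parametric_intervalIntegral_of_continuous' ?_ 0 t
  exact hT.continuous_uncurry.comp
    (f := fun q : (V × V) × ℝ => (q.2.toNNReal, q.1.2)) (by fun_prop)

theorem hasGenerator_of_approx [CompleteSpace V] (hT : IsContractionSemigroup T) {f g : V}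
    (h : ∀ ε > 0, ∃ f' g' : V, HasGenerator T f' g' ∧ ‖f' - f‖ ≤ ε ∧ ‖g' - g‖ ≤ ε) :
    HasGenerator T f g := by
  refine hT.isClosed_setOf_hasGenerator.closure_subset (a := (f, g))
    (Metric.mem_closure_iff.2 fun ε hε => ?_)
  obtain ⟨f', g', hgen, hf, hg⟩ := h (ε / 2) (half_pos hε)
  refine ⟨(f', g'), hgen, ?_⟩
  rw [dist_comm, Prod.dist_eq, dist_eq_norm, dist_eq_norm]
  exact max_lt (hf.trans_lt (half_lt_self hε)) (hg.trans_lt (half_lt_self hε))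

theorem slope_comp_sub {S : ℝ≥0 → V →L[ℝ] V} (hT : IsContractionSemigroup T)
    (hS : IsContractionSemigroup S) (f : V) {r s t : ℝ} (hs : 0 ≤ s) (hsr : s ≤ r)
    (hrt : r ≤ t) :
    slope (fun r : ℝ => T (t - r).toNNReal (S r.toNNReal f)) s r =
      T (t - r).toNNReal
        (((r - s).toNNReal : ℝ)⁻¹ • (S (r - s).toNNReal (S s.toNNReal f) - S s.toNNReal f) -
          ((r - s).toNNReal : ℝ)⁻¹ •
            (T (r - s).toNNReal (S s.toNNReal f) - S s.toNNReal f)) := by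
  have hr : r.toNNReal = (r - s).toNNReal + s.toNNReal := by
    rw [← Real.toNNReal_add (sub_nonneg.2 hsr) hs, sub_add_cancel]
  have ht : (t - s).toNNReal = (t - r).toNNReal + (r - s).toNNReal := by
    rw [← Real.toNNReal_add (sub_nonneg.2 hrt) (sub_nonneg.2 hsr), sub_add_sub_cancel]
  rw [slope_def_module, hr, ht, hS.add, hT.add, ← smul_sub, map_smul,
    Real.coe_toNNReal _ (sub_nonneg.2 hsr), sub_sub_sub_cancel_right, map_sub]
  rfl

/-- The function `r ↦ T (t - r) (S r f)` is constant, because its derivative involves only the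
difference of the two generators at `S r f`. -/
theorem apply_eq_of_hasGenerator {S : ℝ≥0 → V →L[ℝ] V} (hT : IsContractionSemigroup T)
    (hS : IsContractionSemigroup S) {f : V}
    (h : ∀ s, ∃ g, HasGenerator T (S s f) g ∧ HasGenerator S (S s f) g) (t : ℝ≥0) :
    T t f = S t f := by
  have hcont : Continuous fun r : ℝ => T (t - r).toNNReal (S r.toNNReal f) :=
    hT.continuous_uncurry.comp (f := fun r : ℝ => ((t - r).toNNReal, S r.toNNReal f))
      ((by fun_prop : Continuous fun r : ℝ => (t - r).toNNReal).prodMk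
        (hS.continuous_toNNReal_apply f))
  have hder : ∀ s ∈ Set.Ico (0 : ℝ) t, HasDerivWithinAt
      (fun r : ℝ => T (t - r).toNNReal (S r.toNNReal f)) 0 (Set.Ici s) s := by
    intro s hs
    obtain ⟨g, hTg, hSg⟩ := h s.toNNReal
    have hlim : Tendsto (fun r : ℝ => (r - s).toNNReal) (𝓝[>] s) (𝓝[>] 0) :=
      tendsto_nhdsWithin_iff.2
        ⟨((by fun_prop : Continuous fun r : ℝ => (r - s).toNNReal).tendsto' s 0
            (by simp)).mono_left nhdsWithin_le_nhds,
          eventually_mem_nhdsWithin.mono fun r hr => Real.toNNReal_pos.2 (sub_pos.2 hr)⟩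
    have hdiff := ((Tendsto.sub hSg hTg).comp hlim).norm
    rw [sub_self, norm_zero] at hdiff
    rw [hasDerivWithinAt_iff_tendsto_slope, Set.Ici_sdiff_left]
    refine squeeze_zero_norm' ?_ hdiff
    filter_upwards [Ioo_mem_nhdsGT hs.2] with r hr
    rw [hT.slope_comp_sub hS f hs.1 hr.1.le hr.2.le]
    exact hT.norm_apply_le _ _
  have hconst := constant_of_has_deriv_right_zero hcont.continuousOn hder t ⟨t.2, le_rfl⟩
  simpa [hT.zero, hS.zero] using hconst.symm

end IsContractionSemigroup

end Semigroup

/-! ### Positive contractions and Feller semigroups -/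

section Feller

variable {X Y Z : Type*} [TopologicalSpace X] [TopologicalSpace Y] [TopologicalSpace Z]

theorem norm_le_of_abs_le {f : C₀(X, ℝ)} {C : ℝ} (hC : 0 ≤ C) (h : ∀ x, |f x| ≤ C) : ‖f‖ ≤ C :=
  (BoundedContinuousFunction.norm_le hC).2 h

/-- A positive contraction between spaces of continuous functions vanishing at infinity, that is,
the operator of a sub-Markovian transition kernel. -/
structure IsPositiveContraction (A : C₀(X, ℝ) →L[ℝ] C₀(Y, ℝ)) : Prop where
  nonneg : ∀ f : C₀(X, ℝ), (∀ x, 0 ≤ f x) → ∀ y, 0 ≤ A f y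
  norm_le : ‖A‖ ≤ 1

theorem IsPositiveContraction.comp {A : C₀(Y, ℝ) →L[ℝ] C₀(Z, ℝ)} {B : C₀(X, ℝ) →L[ℝ] C₀(Y, ℝ)}
    (hA : IsPositiveContraction A) (hB : IsPositiveContraction B) :
    IsPositiveContraction (A.comp B) where
  nonneg f hf := hA.nonneg _ (hB.nonneg f hf)
  norm_le := (A.opNorm_comp_le B).trans (mul_le_one₀ hA.norm_le (norm_nonneg B) hB.norm_le)

theorem IsPositiveContraction.apply_le_one {A : C₀(X, ℝ) →L[ℝ] C₀(Y, ℝ)}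
    (hA : IsPositiveContraction A) {f : C₀(X, ℝ)} (h0 : ∀ x, 0 ≤ f x) (h1 : ∀ x, f x ≤ 1)
    (y : Y) : A f y ≤ 1 :=
  calc A f y ≤ ‖A f‖ := (le_abs_self _).trans (abs_apply_le_norm _ y)
    _ ≤ ‖f‖ := norm_apply_le_of_norm_le_one hA.norm_le f
    _ ≤ 1 := norm_le_of_abs_le zero_le_one fun x => by rw [abs_of_nonneg (h0 x)]; exact h1 x

theorem isPositiveContraction_kernelOperator {p : X → ℕ → ℝ} (hp : IsC0MarkovKernel p) :
    IsPositiveContraction (kernelOperator p hp) where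
  nonneg _ hf x := tsum_nonneg fun m => mul_nonneg (hp.nonneg x m) (hf m)
  norm_le := LinearMap.mkContinuous_norm_le _ zero_le_one _

theorem isPositiveContraction_dilation {σ : ℝ≥0} (h0 : 0 < σ) :
    IsPositiveContraction (dilation σ h0) where
  nonneg _ hf x := hf (σ * x)
  norm_le := LinearMap.mkContinuous_norm_le _ zero_le_one _

theorem IsC0MarkovKernel.le_one {p : X → ℕ → ℝ} (hp : IsC0MarkovKernel p) (x : X) (m : ℕ) :
    p x m ≤ 1 :=
  le_hasSum (hp.hasSum_one x) m fun k _ => hp.nonneg x k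

theorem IsFellerSemigroup.isContractionSemigroup {T : ℝ≥0 → C₀(X, ℝ) →L[ℝ] C₀(X, ℝ)}
    (hT : IsFellerSemigroup T) : IsContractionSemigroup T :=
  ⟨hT.zero, hT.add, hT.contraction, hT.tendsto_zero⟩

theorem generatorMapsTo_iff {T : ℝ≥0 → C₀(X, ℝ) →L[ℝ] C₀(X, ℝ)} {f g : C₀(X, ℝ)} {h : X → ℝ}
    (hg : ∀ x, g x = h x) : GeneratorMapsTo T f h ↔ HasGenerator T f g := by
  constructor
  · rintro ⟨g', hg', H⟩
    obtain rfl : g' = g := by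
      ext x
      rw [hg, hg']
    exact H
  · exact fun H => ⟨g, hg, H⟩

end Feller

/-! ### Exponential families and the Bessel flow -/

section Flow

variable {X Y : Type*} [TopologicalSpace X] [TopologicalSpace Y] {I J : Set ℝ}
  {e : ℝ → C₀(X, ℝ)} {e' : ℝ → C₀(Y, ℝ)} {β : ℝ}

theorem abs_sub_sub_mul_le {f f₁ f₂ : ℝ → ℝ} {v w δ C : ℝ} (hC : 0 ≤ C)
    (hf : ∀ u ∈ Metric.ball w δ, HasDerivAt f (f₁ u) u)
    (hf₁ : ∀ u ∈ Metric.ball w δ, HasDerivAt f₁ (f₂ u) u)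
    (hf₂ : ∀ u ∈ Metric.ball w δ, |f₂ u| ≤ C) (hv : v ∈ Metric.ball w δ) :
    |f v - f w - (v - w) * f₁ w| ≤ C * |v - w| ^ 2 := by
  have hw : w ∈ Metric.ball w δ := Metric.mem_ball_self (dist_nonneg.trans_lt hv)
  have hsub : Metric.closedBall w (dist v w) ⊆ Metric.ball w δ :=
    Metric.closedBall_subset_ball hv
  have hlip : ∀ u ∈ Metric.closedBall w (dist v w), ‖f₁ u - 1 * f₁ w‖ ≤ C * |v - w| := by
    intro u hu
    rw [one_mul]
    exact ((convex_ball w δ).norm_image_sub_le_of_norm_hasDerivWithin_le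
      (fun z hz => (hf₁ z hz).hasDerivWithinAt) hf₂ hw (hsub hu)).trans
      (mul_le_mul_of_nonneg_left hu hC)
  have hmean := (convex_closedBall w (dist v w)).norm_image_sub_le_of_norm_hasDerivWithin_le
    (f := fun u => f u - u * f₁ w)
    (fun u hu => ((hf u (hsub hu)).sub
      ((hasDerivAt_id' u).mul_const (f₁ w))).hasDerivWithinAt)
    hlip (Metric.mem_closedBall_self dist_nonneg) (Metric.mem_closedBall.2 le_rfl)
  calc |f v - f w - (v - w) * f₁ w| = ‖f v - v * f₁ w - (f w - w * f₁ w)‖ := by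
        rw [Real.norm_eq_abs]; ring_nf
    _ ≤ C * |v - w| * |v - w| := hmean
    _ = C * |v - w| ^ 2 := by ring

theorem hasDerivAt_of_bounded_second_deriv {g : C₀(X, ℝ)} {e₁ e₂ : ℝ → X → ℝ} {w C : ℝ}
    (hC : 0 ≤ C) (he : ∀ᶠ v in 𝓝 w, ∀ x, HasDerivAt (fun v => e v x) (e₁ v x) v)
    (he₁ : ∀ᶠ v in 𝓝 w, ∀ x, HasDerivAt (fun v => e₁ v x) (e₂ v x) v)
    (he₂ : ∀ᶠ v in 𝓝 w, ∀ x, |e₂ v x| ≤ C) (hg : ∀ x, g x = e₁ w x) :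
    HasDerivAt e g w := by
  obtain ⟨δ, hδ, hball⟩ := Metric.eventually_nhds_iff_ball.1 (he.and (he₁.and he₂))
  have htaylor : ∀ᶠ v in 𝓝 w, ‖e v - e w - (v - w) • g‖ ≤ C * ‖‖v - w‖ ^ 2‖ := by
    filter_upwards [Metric.ball_mem_nhds w hδ] with v hv
    rw [Real.norm_of_nonneg (by positivity)]
    refine norm_le_of_abs_le (by positivity) fun x => ?_
    simpa [hg] using abs_sub_sub_mul_le hC (fun u hu => (hball u hu).1 x)
      (fun u hu => (hball u hu).2.1 x) (fun u hu => (hball u hu).2.2 x) hv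
  rw [hasDerivAt_iff_isLittleO]
  exact (Asymptotics.IsBigO.of_bound C htaylor).trans_isLittleO
    (Asymptotics.isLittleO_pow_sub_sub w one_lt_two)

/-- A curve of functions `0 ≤ e w ≤ 1` in `C₀(X)` modelled on the exponentials `x ↦ exp (-w x)`,
parametrized by an interval `I` with left end point `0`: it spans a dense subspace, tends to `1`
pointwise as `w ↓ 0`, and is differentiable in the supremum norm. -/
structure IsExponentialFamily (I : Set ℝ) (e : ℝ → C₀(X, ℝ)) : Prop where
  pos : ∀ w ∈ I, 0 < w
  mem_nhdsGT : I ∈ 𝓝[>] (0 : ℝ)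
  mem_of_le : ∀ v w, w ∈ I → 0 < v → v ≤ w → v ∈ I
  nonneg : ∀ w ∈ I, ∀ x, 0 ≤ e w x
  le_one : ∀ w ∈ I, ∀ x, e w x ≤ 1
  tendsto_one : ∀ x, Tendsto (fun w => e w x) (𝓝[>] 0) (𝓝 1)
  dense_span : Dense (Submodule.span ℝ (e '' I) : Set C₀(X, ℝ))
  differentiableAt : ∀ w ∈ I, DifferentiableAt ℝ e w

/-- The semigroup `T` moves the parameter of `e` along the flow `w ↦ w / (1 + t w)` of the vector
field `-w²`. Both Bessel semigroups have this property, `Q` for `e w = (x ↦ exp (-w x))` and `ℚ`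
for `e w = (n ↦ (1 - w) ^ n)`. -/
def FollowsBesselFlow (β : ℝ) (I : Set ℝ) (e : ℝ → C₀(X, ℝ))
    (T : ℝ≥0 → C₀(X, ℝ) →L[ℝ] C₀(X, ℝ)) : Prop :=
  ∀ (t : ℝ≥0), ∀ w ∈ I, T t (e w) = (1 + t * w) ^ (-β) • e (w / (1 + t * w))

/-- The image of `e w` under the generator of the Bessel flow. -/
def besselGenerator (β : ℝ) (e : ℝ → C₀(X, ℝ)) (w : ℝ) : C₀(X, ℝ) :=
  (-(β * w)) • e w + (-w ^ 2) • deriv e w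

variable {S T : ℝ≥0 → C₀(X, ℝ) →L[ℝ] C₀(X, ℝ)} {T' : ℝ≥0 → C₀(Y, ℝ) →L[ℝ] C₀(Y, ℝ)}

theorem hasGenerator_of_flow {f f' : C₀(X, ℝ)} {a φ : ℝ → ℝ} {a' φ' w : ℝ}
    (hT : ∀ t : ℝ≥0, T t f = a t • e (φ t)) (hf : e w = f) (ha : HasDerivAt a a' 0)
    (ha0 : a 0 = 1) (hφ : HasDerivAt φ φ' 0) (hφ0 : φ 0 = w) (he : HasDerivAt e f' w) :
    HasGenerator T f (a' • f + φ' • f') := by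
  subst hφ0 hf
  have h0 : T 0 (e (φ 0)) = e (φ 0) := by simpa [ha0] using hT 0
  have hderiv := ha.smul (he.scomp 0 hφ)
  rw [hasGenerator_iff_hasDerivWithinAt h0]
  refine ((hderiv.congr_deriv ?_).hasDerivWithinAt).congr_of_mem (fun t ht => ?_)
    Set.self_mem_Ici
  · simp only [Function.comp_apply, ha0, one_smul, add_comm]
  · rw [hT, Real.coe_toNNReal t ht]
    rfl

namespace IsExponentialFamily

theorem div_mem (he : IsExponentialFamily I e) {w : ℝ} (hw : w ∈ I) (t : ℝ≥0) :
    w / (1 + t * w) ∈ I := by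
  have hw0 := he.pos w hw
  have h1 : 1 ≤ 1 + t * w := le_add_of_nonneg_right (by positivity)
  exact he.mem_of_le _ w hw (by positivity) (div_le_self hw0.le h1)

theorem ext (he : IsExponentialFamily I e) {A B : C₀(X, ℝ) →L[ℝ] C₀(Y, ℝ)}
    (h : ∀ w ∈ I, A (e w) = B (e w)) : A = B :=
  ContinuousLinearMap.ext_on he.dense_span (Set.forall_mem_image.2 h)

theorem isFellerSemigroup (he : IsExponentialFamily I e) (hT : ∀ t, IsPositiveContraction (T t))
    (zero : ∀ w ∈ I, T 0 (e w) = e w)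
    (add : ∀ s t, T (s + t) = (T s).comp (T t))
    (mass : ∀ t x, Tendsto (fun w => T t (e w) x) (𝓝[>] 0) (𝓝 1))
    (generator : ∀ w ∈ I, ∃ g, HasGenerator T (e w) g) : IsFellerSemigroup T where
  zero := he.ext zero
  add := add
  nonneg t := (hT t).nonneg
  contraction t := (hT t).norm_le
  markov t x := by
    refine ⟨?_, fun b hb => ?_⟩
    · rintro r ⟨f, h0, h1, rfl⟩
      exact (hT t).apply_le_one h0 h1 x
    · refine le_of_tendsto (mass t x) ?_
      filter_upwards [he.mem_nhdsGT] with w hw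
      exact hb ⟨e w, he.nonneg w hw, he.le_one w hw, rfl⟩
  tendsto_zero := by
    refine tendsto_apply_of_dense_span (B := ContinuousLinearMap.id ℝ _) (fun t => (hT t).norm_le)
      he.dense_span (Set.forall_mem_image.2 fun w hw => ?_)
    obtain ⟨g, hg⟩ := generator w hw
    exact hg.tendsto (zero w hw)

end IsExponentialFamily

namespace FollowsBesselFlow

theorem hasGenerator (hT : FollowsBesselFlow β I e T) (he : IsExponentialFamily I e) {w : ℝ}
    (hw : w ∈ I) : HasGenerator T (e w) (besselGenerator β e w) := by
  have hden : HasDerivAt (fun t : ℝ => 1 + t * w) w 0 := by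
    simpa using ((hasDerivAt_id' (0 : ℝ)).mul_const w).const_add 1
  have ha : HasDerivAt (fun t : ℝ => (1 + t * w) ^ (-β)) (-(β * w)) 0 := by
    simpa [mul_comm] using hden.rpow_const (p := -β) (by simp)
  have hφ : HasDerivAt (fun t : ℝ => w / (1 + t * w)) (-w ^ 2) 0 := by
    simpa [sq] using (hasDerivAt_const (0 : ℝ) w).fun_div hden (by simp)
  exact hasGenerator_of_flow (fun t => hT t w hw) rfl ha (by simp) hφ (by simp)
    (he.differentiableAt w hw).hasDerivAt

theorem add_apply (hT : FollowsBesselFlow β I e T) (he : IsExponentialFamily I e) (s t : ℝ≥0)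
    {w : ℝ} (hw : w ∈ I) : T (s + t) (e w) = T s (T t (e w)) := by
  have hw0 := he.pos w hw
  have ht : 0 < 1 + t * w := by positivity
  have hs : 1 + s * (w / (1 + t * w)) = (1 + (s + t) * w) / (1 + t * w) := by
    field_simp
    ring
  rw [hT t w hw, map_smul, hT s _ (he.div_mem hw t), hT (s + t) w hw, hs, smul_smul,
    ← Real.mul_rpow ht.le (by positivity), div_div_div_cancel_right₀ ht.ne',
    mul_div_cancel₀ _ ht.ne', NNReal.coe_add]

theorem tendsto_apply_one (hT : FollowsBesselFlow β I e T) (he : IsExponentialFamily I e)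
    (t : ℝ≥0) (x : X) : Tendsto (fun w => T t (e w) x) (𝓝[>] 0) (𝓝 1) := by
  have hden : Tendsto (fun w : ℝ => 1 + t * w) (𝓝[>] 0) (𝓝 1) :=
    ((by fun_prop : Continuous fun w : ℝ => 1 + t * w).tendsto' 0 1 (by simp)).mono_left
      nhdsWithin_le_nhds
  have hpow : Tendsto (fun w : ℝ => (1 + t * w) ^ (-β)) (𝓝[>] 0) (𝓝 1) := by
    simpa using hden.rpow_const (p := -β) (Or.inl one_ne_zero)
  have hflow : Tendsto (fun w : ℝ => w / (1 + t * w)) (𝓝[>] 0) (𝓝[>] 0) := by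
    refine tendsto_nhdsWithin_iff.2 ⟨?_, ?_⟩
    · simpa using! (tendsto_id.mono_left nhdsWithin_le_nhds).div hden one_ne_zero
    · filter_upwards [he.mem_nhdsGT] with w hw using he.pos _ (he.div_mem hw t)
  have hlim := hpow.mul ((he.tendsto_one x).comp hflow)
  rw [one_mul] at hlim
  refine hlim.congr' ?_
  filter_upwards [he.mem_nhdsGT] with w hw
  rw [hT t w hw]
  rfl

theorem isFellerSemigroup (hflow : FollowsBesselFlow β I e T) (he : IsExponentialFamily I e)
    (hT : ∀ t, IsPositiveContraction (T t)) : IsFellerSemigroup T :=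
  he.isFellerSemigroup hT (fun w hw => by simpa using hflow 0 w hw)
    (fun s t => he.ext fun _ hw => hflow.add_apply he s t hw) (hflow.tendsto_apply_one he)
    fun _ hw => ⟨_, hflow.hasGenerator he hw⟩

theorem eq_of_hasGenerator (hS : FollowsBesselFlow β I e S) (he : IsExponentialFamily I e)
    (hS' : IsContractionSemigroup S) (hT : IsContractionSemigroup T)
    (h : ∀ w ∈ I, HasGenerator T (e w) (besselGenerator β e w)) : T = S := by
  funext t
  refine he.ext fun w hw => hT.apply_eq_of_hasGenerator hS' (fun s => ?_) t
  rw [hS s w hw]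
  exact ⟨_, (h _ (he.div_mem hw s)).smul _, (hS.hasGenerator he (he.div_mem hw s)).smul _⟩

/-- The case `κ = 1` intertwines two Bessel semigroups; the case `T' = T` is their scaling
property. -/
theorem comp_eq (hT : FollowsBesselFlow β I e T) (hT' : FollowsBesselFlow β J e' T')
    (he : IsExponentialFamily I e) {A : C₀(X, ℝ) →L[ℝ] C₀(Y, ℝ)} {κ : ℝ≥0}
    (hJ : ∀ w ∈ I, κ * w ∈ J) (hA : ∀ w ∈ I, A (e w) = e' (κ * w)) (t : ℝ≥0) :
    (T' t).comp A = A.comp (T (κ * t)) := by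
  refine he.ext fun w hw => ?_
  simp only [ContinuousLinearMap.comp_apply]
  rw [hA w hw, hT' t _ (hJ w hw), hT _ w hw, map_smul, hA _ (he.div_mem hw _), mul_div_assoc,
    NNReal.coe_mul, mul_left_comm (t : ℝ), ← mul_assoc (κ : ℝ)]

end FollowsBesselFlow

end Flow

/-! ### Geometric sequences in `c₀(ℤ₊)` -/

section NullSequences

/-- A null sequence, as an element of `c₀(ℤ₊)`. -/
def ofNullSequence (f : ℕ → ℝ) (hf : Tendsto f atTop (𝓝 0)) : C₀(ℕ, ℝ) where
  toFun := f
  continuous_toFun := continuous_of_discreteTopology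
  zero_at_infty' := by rwa [cocompact_eq_cofinite, Nat.cofinite_eq_atTop]

@[simp]
theorem ofNullSequence_apply (f : ℕ → ℝ) (hf : Tendsto f atTop (𝓝 0)) (n : ℕ) :
    ofNullSequence f hf n = f n := rfl

theorem tendsto_atTop_zero (f : C₀(ℕ, ℝ)) : Tendsto f atTop (𝓝 0) := by
  rw [← Nat.cofinite_eq_atTop, ← cocompact_eq_cofinite]
  exact f.zero_at_infty'

theorem sum_apply {X ι : Type*} [TopologicalSpace X] (s : Finset ι) (f : ι → C₀(X, ℝ)) (x : X) :
    (∑ i ∈ s, f i) x = ∑ i ∈ s, f i x := by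
  classical
  induction s using Finset.induction_on with
  | empty => simp
  | insert a s ha ih => rw [Finset.sum_insert ha, Finset.sum_insert ha, ← ih]; rfl

/-- The indicator of a point of `ℤ₊`. -/
def pointMass (m : ℕ) : C₀(ℕ, ℝ) :=
  ofNullSequence (fun n => if n = m then 1 else 0) <| tendsto_const_nhds.congr' <| by
    filter_upwards [eventually_gt_atTop m] with n hn using (if_neg hn.ne').symm

@[simp]
theorem pointMass_apply (m n : ℕ) : pointMass m n = if n = m then 1 else 0 := rfl

/-- The restriction of a sequence to `{0, …, N - 1}`. -/
def truncation (N : ℕ) (f : ℕ → ℝ) : C₀(ℕ, ℝ) := ∑ m ∈ Finset.range N, f m • pointMass m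

theorem truncation_apply (N : ℕ) (f : ℕ → ℝ) (n : ℕ) :
    truncation N f n = if n < N then f n else 0 := by
  simp [truncation, sum_apply]

theorem exists_truncation_eq {f : C₀(ℕ, ℝ)} (hf : (Function.support f).Finite) :
    ∃ N, truncation N f = f := by
  obtain ⟨N, hN⟩ := hf.bddAbove
  refine ⟨N + 1, ZeroAtInftyContinuousMap.ext fun n => ?_⟩
  rw [truncation_apply, ite_eq_left_iff]
  intro hn
  by_contra h
  exact hn (Nat.lt_succ_of_le (hN (Function.mem_support.2 (Ne.symm h))))

theorem support_pointMass_finite (m : ℕ) : (Function.support (pointMass m)).Finite :=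
  (Set.finite_singleton m).subset fun n hn => by
    by_contra h
    exact hn (if_neg h)

theorem dense_span_pointMass :
    Dense (Submodule.span ℝ (Set.range pointMass) : Set C₀(ℕ, ℝ)) := by
  refine fun f => Metric.mem_closure_iff.2 fun ε hε => ?_
  obtain ⟨N, hN⟩ := Metric.tendsto_atTop.1 (tendsto_atTop_zero f) (ε / 2) (half_pos hε)
  refine ⟨truncation N f, Submodule.sum_mem _ fun m _ => Submodule.smul_mem _ _
    (Submodule.subset_span ⟨m, rfl⟩), ?_⟩
  rw [dist_eq_norm]
  refine (norm_le_of_abs_le (half_pos hε).le fun n => ?_).trans_lt (half_lt_self hε)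
  rw [ZeroAtInftyContinuousMap.sub_apply, truncation_apply]
  split_ifs with h
  · simpa using (half_pos hε).le
  · simpa using (hN n (not_lt.1 h)).le

open Classical in
/-- The geometric sequence `n ↦ (1 - w) ^ n`, with the junk value `0` unless `w ∈ (0, 1)`. -/
def geom (w : ℝ) : C₀(ℕ, ℝ) :=
  if h : w ∈ Set.Ioo 0 1 then
    ofNullSequence (fun n => (1 - w) ^ n)
      (tendsto_pow_atTop_nhds_zero_of_lt_one (sub_nonneg.2 h.2.le) (sub_lt_self 1 h.1))
  else 0

variable {w : ℝ}

theorem geom_apply (hw : w ∈ Set.Ioo 0 1) (n : ℕ) : geom w n = (1 - w) ^ n := by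
  rw [geom, dif_pos hw, ofNullSequence_apply]

theorem abs_sub_pointMass_le {z : ℝ} (hz0 : 0 < z) (hz1 : z ≤ 1 / 2) (m n : ℕ) :
    |((z ^ m)⁻¹ • (geom (1 - z) - truncation m (z ^ ·)) - pointMass m) n|
      ≤ 2 ^ (m + 1) * z * (1 / 2) ^ n := by
  have hvalue : ((z ^ m)⁻¹ • (geom (1 - z) - truncation m (z ^ ·)) - pointMass m) n
      = (z ^ m)⁻¹ * (z ^ n - if n < m then z ^ n else 0) - if n = m then 1 else 0 := by
    rw [ZeroAtInftyContinuousMap.sub_apply, ZeroAtInftyContinuousMap.smul_apply,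
      ZeroAtInftyContinuousMap.sub_apply, truncation_apply, pointMass_apply,
      geom_apply ⟨by linarith, by linarith⟩, sub_sub_cancel, smul_eq_mul]
  rw [hvalue]
  rcases lt_trichotomy n m with h | rfl | h
  · simp only [h, h.ne, if_true, if_false, sub_self, mul_zero, abs_zero]
    positivity
  · simp only [lt_irrefl, if_true, if_false, sub_zero, inv_mul_cancel₀ (pow_pos hz0 n).ne',
      sub_self, abs_zero]
    positivity
  · obtain ⟨k, rfl⟩ := Nat.exists_eq_add_of_lt h
    have hzk : (z ^ m)⁻¹ * z ^ (m + k + 1) = z * z ^ k := by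
      field_simp
      ring
    have hhalf : (2 : ℝ) ^ (m + 1) * (1 / 2) ^ (m + k + 1) = (1 / 2) ^ k := by
      rw [add_right_comm, pow_add (1 / 2 : ℝ), ← mul_assoc, ← mul_pow]
      norm_num
    rw [if_neg h.not_gt, if_neg h.ne', sub_zero, sub_zero, hzk, abs_of_pos (by positivity),
      mul_right_comm, hhalf, mul_comm]
    gcongr

theorem exists_approx_pointMass (m : ℕ) {ε : ℝ} (hε : 0 < ε) :
    ∃ z : ℝ, 1 - z ∈ Set.Ioo 0 1 ∧ ∀ n,
      |((z ^ m)⁻¹ • (geom (1 - z) - truncation m (z ^ ·)) - pointMass m) n|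
        ≤ ε * (1 / 2) ^ n := by
  refine ⟨min (1 / 2) (ε / 2 ^ (m + 1)), ?_, fun n => ?_⟩
  · have hpos : 0 < min (1 / 2) (ε / 2 ^ (m + 1)) := by positivity
    have hle := min_le_left (1 / 2) (ε / 2 ^ (m + 1))
    constructor <;> linarith
  · refine (abs_sub_pointMass_le (by positivity) (min_le_left _ _) m n).trans ?_
    gcongr
    rw [← le_div_iff₀' (by positivity)]
    exact min_le_right _ _

theorem truncation_mem {p : Submodule ℝ C₀(ℕ, ℝ)} {N : ℕ} (h : ∀ m < N, pointMass m ∈ p)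
    (f : ℕ → ℝ) : truncation N f ∈ p :=
  Submodule.sum_mem _ fun m hm => Submodule.smul_mem _ _ (h m (Finset.mem_range.1 hm))

theorem pointMass_mem_closure_span_geom (m : ℕ) :
    pointMass m ∈ (Submodule.span ℝ (geom '' Set.Ioo 0 1)).topologicalClosure := by
  induction m using Nat.strong_induction_on with
  | _ m ih =>
    refine (Submodule.isClosed_topologicalClosure _).closure_subset
      (Metric.mem_closure_iff.2 fun ε hε => ?_)
    obtain ⟨z, hz, happrox⟩ := exists_approx_pointMass m (half_pos hε)
    refine ⟨_, Submodule.smul_mem _ (z ^ m)⁻¹ (Submodule.sub_mem _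
      (Submodule.le_topologicalClosure _ (Submodule.subset_span ⟨1 - z, hz, rfl⟩))
      (truncation_mem ih (z ^ ·))), ?_⟩
    rw [dist_comm, dist_eq_norm]
    refine (norm_le_of_abs_le (half_pos hε).le fun n => (happrox n).trans ?_).trans_lt
      (half_lt_self hε)
    exact mul_le_of_le_one_right (half_pos hε).le (pow_le_one₀ (by norm_num) (by norm_num))

theorem dense_span_geom : Dense (Submodule.span ℝ (geom '' Set.Ioo 0 1) : Set C₀(ℕ, ℝ)) := by
  rw [Submodule.dense_iff_topologicalClosure_eq_top, eq_top_iff,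
    ← Submodule.dense_iff_topologicalClosure_eq_top.1 dense_span_pointMass]
  exact Submodule.topologicalClosure_minimal _
    (Submodule.span_le.2 (Set.range_subset_iff.2 pointMass_mem_closure_span_geom))
    (Submodule.isClosed_topologicalClosure _)

theorem natCast_mul_pow_eq (hw : 0 < w) (n : ℕ) :
    n * (1 - w) ^ (n - 1) = w⁻¹ * binomialKernel w n 1 := by
  rw [binomialKernel, Nat.choose_one_right]
  field_simp

theorem natCast_mul_natCast_pred_mul_pow_eq (hw : 0 < w) (n : ℕ) :
    n * (((n - 1 : ℕ) : ℝ) * (1 - w) ^ (n - 2)) = 2 / w ^ 2 * binomialKernel w n 2 := by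
  rcases n with _ | n
  · simp [binomialKernel]
  · rw [binomialKernel, Nat.cast_choose_two]
    push_cast
    field_simp
    simp [mul_comm]

theorem hasDerivAt_geom (hw : w ∈ Set.Ioo 0 1) :
    ∃ g, HasDerivAt geom g w ∧ ∀ n : ℕ, g n = -(n * (1 - w) ^ (n - 1)) := by
  have hnull : Tendsto (fun n => -w⁻¹ * binomialKernel w n 1) atTop (𝓝 0) := by
    simpa [cocompact_eq_cofinite, Nat.cofinite_eq_atTop] using
      ((isC0MarkovKernel_binomialKernel hw.1 hw.2.le).tendsto_zero 1).const_mul (-w⁻¹)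
  have hg : ∀ n : ℕ, ofNullSequence _ hnull n = -(n * (1 - w) ^ (n - 1)) := fun n => by
    rw [ofNullSequence_apply, natCast_mul_pow_eq hw.1, neg_mul]
  have hpow : ∀ (k : ℕ) (v : ℝ),
      HasDerivAt (fun v : ℝ => (1 - v) ^ k) (-(k * (1 - v) ^ (k - 1))) v := fun k v => by
    simpa using ((hasDerivAt_id' v).const_sub 1).fun_pow k
  refine ⟨_, hasDerivAt_of_bounded_second_deriv (C := 2 / (w / 2) ^ 2)
    (e₁ := fun v (n : ℕ) => -(n * (1 - v) ^ (n - 1)))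
    (e₂ := fun v (n : ℕ) => n * (((n - 1 : ℕ) : ℝ) * (1 - v) ^ (n - 2))) (by positivity)
    ?_ ?_ ?_ hg, hg⟩
  · filter_upwards [isOpen_Ioo.mem_nhds hw] with v hv n
    refine (hpow n v).congr_of_eventuallyEq ?_
    filter_upwards [isOpen_Ioo.mem_nhds hv] with u hu using geom_apply hu n
  · refine Eventually.of_forall fun v n => ?_
    simpa [Nat.sub_sub] using ((hpow (n - 1) v).const_mul (n : ℝ)).fun_neg
  · filter_upwards [Ioo_mem_nhds (half_lt_self hw.1) hw.2] with v hv n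
    have hw2 : 0 < w / 2 := half_pos hw.1
    have hv0 : 0 < v := hw2.trans hv.1
    have hp := isC0MarkovKernel_binomialKernel hv0 hv.2.le
    rw [natCast_mul_natCast_pred_mul_pow_eq hv0,
      abs_of_nonneg (mul_nonneg (by positivity) (hp.nonneg n 2))]
    calc 2 / v ^ 2 * binomialKernel v n 2 ≤ 2 / v ^ 2 :=
          mul_le_of_le_one_right (by positivity) (hp.le_one n 2)
      _ ≤ 2 / (w / 2) ^ 2 := by gcongr; exact hv.1.le

theorem deriv_geom_apply (hw : w ∈ Set.Ioo 0 1) (n : ℕ) :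
    deriv geom w n = -(n * (1 - w) ^ (n - 1)) := by
  obtain ⟨g, hg, hgn⟩ := hasDerivAt_geom hw
  rw [hg.deriv, hgn]

theorem isExponentialFamily_geom : IsExponentialFamily (Set.Ioo 0 1) geom where
  pos _ hw := hw.1
  mem_nhdsGT := Ioo_mem_nhdsGT one_pos
  mem_of_le _ _ hw hv hvw := ⟨hv, hvw.trans_lt hw.2⟩
  nonneg _ hw n := by
    rw [geom_apply hw]
    exact pow_nonneg (sub_nonneg.2 hw.2.le) n
  le_one _ hw n := by
    rw [geom_apply hw]
    exact pow_le_one₀ (sub_nonneg.2 hw.2.le) (sub_le_self 1 hw.1.le)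
  tendsto_one n := by
    have hcont : Continuous fun w : ℝ => (1 - w) ^ n := by fun_prop
    refine ((hcont.tendsto' 0 1 (by simp)).mono_left nhdsWithin_le_nhds).congr' ?_
    filter_upwards [Ioo_mem_nhdsGT one_pos] with w hw using (geom_apply hw n).symm
  dense_span := dense_span_geom
  differentiableAt _ hw := (hasDerivAt_geom hw).choose_spec.1.differentiableAt

theorem mul_mem_Ioo {σ : ℝ} (hσ : σ ∈ Set.Ioc (0 : ℝ) 1) (hw : w ∈ Set.Ioo 0 1) :
    σ * w ∈ Set.Ioo 0 1 :=
  ⟨mul_pos hσ.1 hw.1, (mul_le_of_le_one_left hw.1.le hσ.2).trans_lt hw.2⟩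

theorem discreteDilation_geom {σ : ℝ} (h0 : 0 < σ) (h1 : σ ≤ 1) (hw : w ∈ Set.Ioo 0 1) :
    discreteDilation σ h0 h1 (geom w) = geom (σ * w) := by
  ext n
  have hσw := mul_mem_Ioo ⟨h0, h1⟩ hw
  have hbinom := add_pow (σ * (1 - w)) (1 - σ) n
  rw [show σ * (1 - w) + (1 - σ) = 1 - σ * w by ring] at hbinom
  rw [discreteDilation_apply, geom_apply hσw, hbinom]
  refine Finset.sum_congr rfl fun m _ => ?_
  rw [geom_apply hw, mul_pow]
  ring

end NullSequences

/-! ### Generators of birth–death type -/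

section BirthDeath

variable {b d : ℕ → ℝ} {T : ℝ≥0 → C₀(ℕ, ℝ) →L[ℝ] C₀(ℕ, ℝ)} {B β w : ℝ}

theorem birthDeathOperator_add (b d : ℕ → ℝ) (f g : C₀(ℕ, ℝ)) (n : ℕ) :
    birthDeathOperator b d (f + g) n
      = birthDeathOperator b d f n + birthDeathOperator b d g n := by
  simp only [birthDeathOperator, Pi.add_apply]
  ring

theorem birthDeathOperator_smul (b d : ℕ → ℝ) (c : ℝ) (f : C₀(ℕ, ℝ)) (n : ℕ) :
    birthDeathOperator b d (c • f) n = c * birthDeathOperator b d f n := by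
  simp only [birthDeathOperator, Pi.smul_apply, smul_eq_mul]
  ring

/-- The space of functions on which the generator of `T` is `b ∂₊ + d ∂₋`. -/
def birthDeathDomain (b d : ℕ → ℝ) (T : ℝ≥0 → C₀(ℕ, ℝ) →L[ℝ] C₀(ℕ, ℝ)) :
    Submodule ℝ C₀(ℕ, ℝ) where
  carrier := {f | GeneratorMapsTo T f (birthDeathOperator b d f)}
  zero_mem' := ⟨0, fun n => by simp [birthDeathOperator], by simp⟩
  add_mem' := by
    rintro f f' ⟨g, hg, H⟩ ⟨g', hg', H'⟩
    refine ⟨g + g', fun n => ?_, HasGenerator.add H H'⟩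
    rw [ZeroAtInftyContinuousMap.add_apply, hg, hg', ← birthDeathOperator_add]
    rfl
  smul_mem' := by
    rintro c f ⟨g, hg, H⟩
    refine ⟨c • g, fun n => ?_, HasGenerator.smul H c⟩
    rw [ZeroAtInftyContinuousMap.smul_apply, hg, smul_eq_mul, ← birthDeathOperator_smul]
    rfl

theorem mem_birthDeathDomain {f : C₀(ℕ, ℝ)} :
    f ∈ birthDeathDomain b d T ↔ GeneratorMapsTo T f (birthDeathOperator b d f) := Iff.rfl

theorem add_one_mul_pow_pred_le {y : ℝ} (hy : y ∈ Set.Ioo 0 1) (n : ℕ) :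
    (n + 1) * y ^ (n - 1) ≤ 2 / (1 - y) := by
  have hy' : 0 < 1 - y := sub_pos.2 hy.2
  have hbinom := (isC0MarkovKernel_binomialKernel hy' (sub_le_self 1 hy.1.le)).le_one n 1
  have hmul := natCast_mul_pow_eq hy' n
  rw [sub_sub_cancel] at hmul
  rw [le_div_iff₀ hy', add_mul, hmul, one_mul, add_mul, mul_right_comm, inv_mul_cancel₀ hy'.ne',
    one_mul, ← one_add_one_eq_two]
  exact add_le_add hbinom
    (mul_le_one₀ (pow_le_one₀ hy.1.le hy.2.le) hy'.le (sub_le_self 1 hy.1.le))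

theorem abs_birthDeathOperator_le (hB : ∀ n : ℕ, |b n| + |d n| ≤ B * (n + 1)) {c y : ℝ}
    (hc : 0 ≤ c) (hy : y ∈ Set.Ioo 0 1) {r : ℕ → ℝ} (hr : ∀ n, |r n| ≤ c * y ^ n) (n : ℕ) :
    |birthDeathOperator b d r n| ≤ 4 * B / (1 - y) * c := by
  have hB0 : 0 ≤ B := by simpa using (by positivity : (0 : ℝ) ≤ |b 0| + |d 0|).trans (hB 0)
  have hle : ∀ m, n - 1 ≤ m → |r m| ≤ c * y ^ (n - 1) := fun m hm =>
    (hr m).trans (mul_le_mul_of_nonneg_left (pow_le_pow_of_le_one hy.1.le hy.2.le hm) hc)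
  have hdiff : ∀ m, n - 1 ≤ m → |r m - r n| ≤ 2 * (c * y ^ (n - 1)) := fun m hm =>
    (abs_sub _ _).trans (by linarith [hle m hm, hle n (Nat.sub_le n 1)])
  calc |birthDeathOperator b d r n|
      ≤ |b n| * |r (n + 1) - r n| + |d n| * |r (n - 1) - r n| := by
        rw [← abs_mul, ← abs_mul]
        exact abs_add_le _ _
    _ ≤ (|b n| + |d n|) * (2 * (c * y ^ (n - 1))) := by
        rw [add_mul]
        gcongr
        · exact hdiff _ (by omega)
        · exact hdiff _ le_rfl
    _ ≤ B * (n + 1) * (2 * (c * y ^ (n - 1))) :=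
        mul_le_mul_of_nonneg_right (hB n) (mul_nonneg zero_le_two
          (mul_nonneg hc (pow_nonneg hy.1.le _)))
    _ = 2 * B * c * ((n + 1) * y ^ (n - 1)) := by ring
    _ ≤ 2 * B * c * (2 / (1 - y)) := by gcongr; exact add_one_mul_pow_pred_le hy n
    _ = 4 * B / (1 - y) * c := by ring

theorem tendsto_atTop_zero_of_approx {f : ℕ → ℝ}
    (h : ∀ ε > 0, ∃ g : C₀(ℕ, ℝ), ∀ n, |g n - f n| ≤ ε) : Tendsto f atTop (𝓝 0) := by
  refine Metric.tendsto_atTop.2 fun ε hε => ?_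
  obtain ⟨g, hg⟩ := h (ε / 2) (half_pos hε)
  obtain ⟨N, hN⟩ := Metric.tendsto_atTop.1 (tendsto_atTop_zero g) (ε / 2) (half_pos hε)
  refine ⟨N, fun n hn => ?_⟩
  calc dist (f n) 0 ≤ dist (f n) (g n) + dist (g n) 0 := dist_triangle _ _ _
    _ < ε / 2 + ε / 2 := by
        rw [dist_comm (f n)]
        exact add_lt_add_of_le_of_lt (hg n) (hN n hn)
    _ = ε := add_halves ε

theorem mem_birthDeathDomain_of_approx (hT : IsContractionSemigroup T)
    (hB : ∀ n : ℕ, |b n| + |d n| ≤ B * (n + 1)) {f : C₀(ℕ, ℝ)} {y : ℝ} (hy : y ∈ Set.Ioo 0 1)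
    (h : ∀ ε > 0, ∃ f' ∈ birthDeathDomain b d T, ∀ n, |(f' - f) n| ≤ ε * y ^ n) :
    f ∈ birthDeathDomain b d T := by
  have happrox : ∀ ε > 0, ∃ f' g' : C₀(ℕ, ℝ), HasGenerator T f' g' ∧ ‖f' - f‖ ≤ ε ∧
      ∀ n, |g' n - birthDeathOperator b d f n| ≤ ε := by
    intro ε hε
    have hM : 0 < 1 + |4 * B / (1 - y)| := by positivity
    obtain ⟨f', ⟨g', hg', hgen⟩, hf'⟩ := h (ε / (1 + |4 * B / (1 - y)|)) (by positivity)
    refine ⟨f', g', hgen, norm_le_of_abs_le hε.le fun n => (hf' n).trans ?_, fun n => ?_⟩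
    · exact (mul_le_of_le_one_right (by positivity) (pow_le_one₀ hy.1.le hy.2.le)).trans
        (div_le_self hε.le (le_add_of_nonneg_right (abs_nonneg _)))
    · have hlin : birthDeathOperator b d (f' - f) n
          = birthDeathOperator b d f' n - birthDeathOperator b d f n := by
        simp only [birthDeathOperator, Pi.sub_apply]
        ring
      rw [hg', ← hlin]
      refine (abs_birthDeathOperator_le hB (by positivity) hy hf' n).trans ?_
      rw [← mul_div_assoc, div_le_iff₀ hM, mul_comm]
      exact mul_le_mul_of_nonneg_left ((le_abs_self _).trans (le_add_of_nonneg_left zero_le_one))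
        hε.le
  have hnull : Tendsto (birthDeathOperator b d f) atTop (𝓝 0) :=
    tendsto_atTop_zero_of_approx fun ε hε => by
      obtain ⟨-, g', -, -, hg'⟩ := happrox ε hε
      exact ⟨g', hg'⟩
  refine ⟨ofNullSequence _ hnull, fun n => rfl, hT.hasGenerator_of_approx fun ε hε => ?_⟩
  obtain ⟨f', g', hgen, hf', hg'⟩ := happrox ε hε
  exact ⟨f', g', hgen, hf', norm_le_of_abs_le hε.le hg'⟩

theorem geom_mem_birthDeathDomain (hT : IsContractionSemigroup T)
    (hB : ∀ n : ℕ, |b n| + |d n| ≤ B * (n + 1)) (h : ∀ m, pointMass m ∈ birthDeathDomain b d T)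
    (hw : w ∈ Set.Ioo 0 1) : geom w ∈ birthDeathDomain b d T := by
  have hz : 0 < 1 - w := sub_pos.2 hw.2
  have hy : √(1 - w) ∈ Set.Ioo 0 1 := by
    refine ⟨Real.sqrt_pos.2 hz, ?_⟩
    rw [Real.sqrt_lt' one_pos]
    linarith [hw.1]
  refine mem_birthDeathDomain_of_approx hT hB hy fun ε hε => ?_
  obtain ⟨N, hN⟩ := exists_pow_lt_of_lt_one hε hy.2
  refine ⟨truncation N (geom w), truncation_mem (fun m _ => h m) _, fun n => ?_⟩
  rw [ZeroAtInftyContinuousMap.sub_apply, truncation_apply]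
  split_ifs with hn
  · rw [sub_self, abs_zero]
    exact mul_nonneg hε.le (pow_nonneg hy.1.le n)
  · have hsq : (1 - w) ^ n = √(1 - w) ^ n * √(1 - w) ^ n := by
      rw [← mul_pow, Real.mul_self_sqrt hz.le]
    rw [zero_sub, abs_neg, geom_apply hw, abs_of_nonneg (by positivity), hsq]
    gcongr
    exact (pow_le_pow_of_le_one hy.1.le hy.2.le (not_lt.1 hn)).trans hN.le

theorem pointMass_mem_birthDeathDomain (hT : IsContractionSemigroup T)
    (hB : ∀ n : ℕ, |b n| + |d n| ≤ B * (n + 1))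
    (h : ∀ w ∈ Set.Ioo 0 1, geom w ∈ birthDeathDomain b d T) (m : ℕ) :
    pointMass m ∈ birthDeathDomain b d T := by
  induction m using Nat.strong_induction_on with
  | _ m ih =>
    refine mem_birthDeathDomain_of_approx hT hB (y := 1 / 2) (by norm_num) fun ε hε => ?_
    obtain ⟨z, hz, happrox⟩ := exists_approx_pointMass m hε
    exact ⟨_, Submodule.smul_mem _ (z ^ m)⁻¹ (Submodule.sub_mem _ (h _ hz)
      (truncation_mem ih (z ^ ·))), happrox⟩

/-- Although the geometric sequences are not finitely supported, the generator may be tested on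
them: both families approximate each other exponentially fast, which absorbs rates of linear
growth. -/
theorem forall_generatorMapsTo_iff (hT : IsContractionSemigroup T)
    (hB : ∀ n : ℕ, |b n| + |d n| ≤ B * (n + 1)) :
    (∀ f : C₀(ℕ, ℝ), (Function.support f).Finite →
      GeneratorMapsTo T f (birthDeathOperator b d f)) ↔
    ∀ w ∈ Set.Ioo (0 : ℝ) 1, GeneratorMapsTo T (geom w) (birthDeathOperator b d (geom w)) := by
  refine ⟨fun h w hw => geom_mem_birthDeathDomain hT hB (fun m => ?_) hw, fun h f hf => ?_⟩
  · exact h _ (support_pointMass_finite m)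
  · obtain ⟨N, hN⟩ := exists_truncation_eq hf
    rw [← mem_birthDeathDomain, ← hN]
    exact truncation_mem (fun m _ => pointMass_mem_birthDeathDomain hT hB h m) f

theorem birthDeathOperator_geom (β κ : ℝ) (hw : w ∈ Set.Ioo 0 1) (n : ℕ) :
    birthDeathOperator (fun n => n + β) (fun n => κ * n) (geom w) n
      = ((-(β * w)) • geom w + (-(w * (κ - 1 + w))) • deriv geom w) n := by
  rw [ZeroAtInftyContinuousMap.add_apply, ZeroAtInftyContinuousMap.smul_apply,
    ZeroAtInftyContinuousMap.smul_apply, deriv_geom_apply hw]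
  simp only [birthDeathOperator, geom_apply hw, smul_eq_mul]
  rcases n with _ | n
  · simp
  · simp only [Nat.add_sub_cancel, pow_succ]
    ring

theorem forall_generatorMapsTo_linear_iff {κ : ℝ} (hT : IsContractionSemigroup T) :
    (∀ f : C₀(ℕ, ℝ), (Function.support f).Finite →
      GeneratorMapsTo T f (birthDeathOperator (fun n => n + β) (fun n => κ * n) f)) ↔
    ∀ w ∈ Set.Ioo (0 : ℝ) 1, HasGenerator T (geom w)
      ((-(β * w)) • geom w + (-(w * (κ - 1 + w))) • deriv geom w) := by
  have hB : ∀ n : ℕ, |n + β| + |κ * n| ≤ (1 + |β| + |κ|) * (n + 1) := fun n => by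
    have hadd := abs_add_le (n : ℝ) β
    have hn : (0 : ℝ) ≤ n := n.cast_nonneg
    rw [abs_mul, Nat.abs_cast] at *
    nlinarith [abs_nonneg β, abs_nonneg κ, mul_nonneg (abs_nonneg β) hn]
  rw [forall_generatorMapsTo_iff hT hB]
  exact forall₂_congr fun w hw =>
    generatorMapsTo_iff fun n => (birthDeathOperator_geom β κ hw n).symm

end BirthDeath

/-! ### The linear birth–death semigroup -/

section LinearBirthDeath

variable {β w : ℝ}

theorem ascPochhammer_eval_nonneg {a : ℝ} (ha : 0 ≤ a) (k : ℕ) :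
    0 ≤ (ascPochhammer ℝ k).eval a := by
  induction k with
  | zero => simp
  | succ k ih => rw [ascPochhammer_succ_eval]; positivity

theorem multichoose_nonneg {a : ℝ} (ha : 0 ≤ a) (k : ℕ) : 0 ≤ Ring.multichoose a k := by
  have h := Ring.factorial_nsmul_multichoose_eq_ascPochhammer a k
  rw [nsmul_eq_mul, Polynomial.ascPochhammer_smeval_eq_eval] at h
  exact nonneg_of_mul_nonneg_right (h ▸ ascPochhammer_eval_nonneg ha k) (by positivity)

theorem hasSum_multichoose_mul_pow (a : ℝ) {y : ℝ} (hy0 : 0 ≤ y) (hy1 : y < 1) :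
    HasSum (fun k => Ring.multichoose a k * y ^ k) ((1 - y) ^ (-a)) := by
  have hy : y ∈ Metric.eball (0 : ℝ) 1 := by
    rw [← ENNReal.ofReal_one, Metric.eball_ofReal, Metric.mem_ball, dist_zero_right,
      Real.norm_of_nonneg hy0]
    exact hy1
  have h := (Real.one_div_one_sub_rpow_hasFPowerSeriesOnBall_zero a).hasSum hy
  rw [zero_add, one_div, ← Real.rpow_neg (by linarith)] at h
  refine h.congr_fun fun k => ?_
  rw [FormalMultilinearSeries.ofScalars_apply_eq, smul_eq_mul, Ring.choose]
  congr 2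
  ring

/-- The transition probabilities at time `log (1 + t)` of the pure birth process with birth rates
`n + β`, which are negative binomial. -/
def birthKernel (β : ℝ) (t : ℝ≥0) (n m : ℕ) : ℝ :=
  if n ≤ m then Ring.multichoose (n + β) (m - n) *
    ((1 + (t : ℝ)) ^ (-((n : ℝ) + β)) * (t / (1 + t)) ^ (m - n)) else 0

theorem hasSum_birthKernel_mul_pow (β : ℝ) (t : ℝ≥0) (n : ℕ) {z : ℝ} (hz0 : 0 ≤ z)
    (hz1 : z ≤ 1) : HasSum (fun m => birthKernel β t n m * z ^ m)
      (z ^ n * (1 + t * (1 - z)) ^ (-((n : ℝ) + β))) := by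
  have ht : (0 : ℝ) < 1 + t := by positivity
  have hy1 : (t : ℝ) / (1 + t) * z < 1 := by
    rw [div_mul_eq_mul_div, div_lt_one ht]
    nlinarith [t.coe_nonneg]
  have hseries := (hasSum_multichoose_mul_pow ((n : ℝ) + β) (by positivity) hy1).mul_left
    (z ^ n * (1 + (t : ℝ)) ^ (-((n : ℝ) + β)))
  have hbase : (1 + (t : ℝ)) * (1 - t / (1 + t) * z) = 1 + t * (1 - z) := by
    field_simp
    ring
  rw [mul_assoc, ← Real.mul_rpow ht.le (by linarith), hbase] at hseries
  rw [← (add_right_injective n).hasSum_iff]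
  · refine hseries.congr_fun fun k => ?_
    simp only [Function.comp_apply, birthKernel]
    rw [if_pos (Nat.le_add_right n k), Nat.add_sub_cancel_left, pow_add, mul_pow]
    ring
  · intro m hm
    rw [birthKernel, if_neg fun h => hm ⟨m - n, Nat.add_sub_cancel' h⟩, zero_mul]

theorem isC0MarkovKernel_birthKernel (hβ : 0 ≤ β) (t : ℝ≥0) :
    IsC0MarkovKernel (birthKernel β t) where
  nonneg n m := by
    have := multichoose_nonneg (a := (n : ℝ) + β) (by positivity) (m - n)
    unfold birthKernel
    positivity
  hasSum_one n := by
    simpa using hasSum_birthKernel_mul_pow β t n zero_le_one le_rfl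
  continuous m := continuous_of_discreteTopology
  tendsto_zero m := by
    rw [cocompact_eq_cofinite, Nat.cofinite_eq_atTop]
    refine tendsto_const_nhds.congr' ?_
    filter_upwards [eventually_gt_atTop m] with n hn using (if_neg hn.not_ge).symm

/-- The semigroup of the pure birth process with birth rates `n + β`, at time `log (1 + t)`. -/
def pureBirth (hβ : 0 ≤ β) (t : ℝ≥0) : C₀(ℕ, ℝ) →L[ℝ] C₀(ℕ, ℝ) :=
  kernelOperator (birthKernel β t) (isC0MarkovKernel_birthKernel hβ t)

theorem pureBirth_geom (hβ : 0 ≤ β) (t : ℝ≥0) (hw : w ∈ Set.Ioo 0 1) :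
    pureBirth hβ t (geom w) = (1 + t * w) ^ (-β) • geom ((1 + t) * w / (1 + t * w)) := by
  have hw0 := hw.1
  have hpos : (0 : ℝ) < 1 + t * w := by positivity
  have hmem : (1 + t) * w / (1 + t * w) ∈ Set.Ioo 0 1 := by
    refine ⟨by positivity, ?_⟩
    rw [div_lt_one hpos]
    linarith [hw.2]
  have hflow : 1 - (1 + t) * w / (1 + t * w) = (1 - w) / (1 + t * w) := by
    field_simp
    ring
  ext n
  have hsum := hasSum_birthKernel_mul_pow β t n (sub_nonneg.2 hw.2.le) (sub_le_self 1 hw0.le)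
  rw [sub_sub_cancel, neg_add, Real.rpow_add hpos, Real.rpow_neg hpos.le, Real.rpow_natCast]
    at hsum
  change ∑' m, birthKernel β t n m * geom w m = _ * geom _ n
  simp only [geom_apply hw, geom_apply hmem, hsum.tsum_eq, hflow, div_pow]
  field_simp

/-- The semigroup of the linear birth–death process: pure birth, followed by independent survival
of each individual with probability `1 / (1 + t)`. -/
def linearBirthDeath (hβ : 0 ≤ β) (t : ℝ≥0) : C₀(ℕ, ℝ) →L[ℝ] C₀(ℕ, ℝ) :=
  (discreteDilation (1 + t)⁻¹ (by positivity)
    (inv_le_one_of_one_le₀ (le_add_of_nonneg_right t.2))).comp (pureBirth hβ t)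

theorem isPositiveContraction_linearBirthDeath (hβ : 0 ≤ β) (t : ℝ≥0) :
    IsPositiveContraction (linearBirthDeath hβ t) :=
  (isPositiveContraction_kernelOperator _).comp (isPositiveContraction_kernelOperator _)

theorem followsBesselFlow_linearBirthDeath (hβ : 0 ≤ β) :
    FollowsBesselFlow β (Set.Ioo 0 1) geom (linearBirthDeath hβ) := by
  intro t w hw
  have hw0 := hw.1
  have hmem : (1 + t) * w / (1 + t * w) ∈ Set.Ioo 0 1 := by
    refine ⟨by positivity, ?_⟩
    rw [div_lt_one (by positivity)]
    linarith [hw.2]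
  rw [linearBirthDeath, ContinuousLinearMap.comp_apply, pureBirth_geom hβ t hw, map_smul,
    discreteDilation_geom _ _ hmem, ← mul_div_assoc, inv_mul_cancel_left₀ (by positivity)]

theorem isFellerSemigroup_linearBirthDeath (hβ : 0 ≤ β) :
    IsFellerSemigroup (linearBirthDeath hβ) :=
  (followsBesselFlow_linearBirthDeath hβ).isFellerSemigroup isExponentialFamily_geom
    (isPositiveContraction_linearBirthDeath hβ)

theorem isBirthDeathSemigroup_linear_iff (hβ : 0 ≤ β) {κ : ℝ≥0}
    {T : ℝ≥0 → C₀(ℕ, ℝ) →L[ℝ] C₀(ℕ, ℝ)} (hT : IsFellerSemigroup T) :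
    IsBirthDeathSemigroup (fun n => n + β) (fun n => κ * n) T ↔
      ∀ w ∈ Set.Ioo (0 : ℝ) 1, HasGenerator T (geom w)
        ((-(β * w)) • geom w + (-(w * (κ - 1 + w))) • deriv geom w) := by
  rw [← forall_generatorMapsTo_linear_iff hT.isContractionSemigroup]
  exact ⟨fun h => h.generator, fun h => ⟨fun n => by positivity, fun n => by positivity,
    by simp, hT, h⟩⟩

theorem isBirthDeathSemigroup_iff_besselGenerator (hβ : 0 ≤ β)
    {T : ℝ≥0 → C₀(ℕ, ℝ) →L[ℝ] C₀(ℕ, ℝ)} (hT : IsFellerSemigroup T) :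
    IsBirthDeathSemigroup (fun n => n + β) (fun n => n) T ↔
      ∀ w ∈ Set.Ioo (0 : ℝ) 1, HasGenerator T (geom w) (besselGenerator β geom w) := by
  simpa [besselGenerator, sq] using isBirthDeathSemigroup_linear_iff (κ := 1) hβ hT

theorem isBirthDeathSemigroup_linearBirthDeath (hβ : 0 ≤ β) :
    IsBirthDeathSemigroup (fun n => n + β) (fun n => n) (linearBirthDeath hβ) :=
  (isBirthDeathSemigroup_iff_besselGenerator hβ (isFellerSemigroup_linearBirthDeath hβ)).2
    fun _ hw => (followsBesselFlow_linearBirthDeath hβ).hasGenerator isExponentialFamily_geom hw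

theorem IsBirthDeathSemigroup.eq_linearBirthDeath (hβ : 0 ≤ β)
    {T : ℝ≥0 → C₀(ℕ, ℝ) →L[ℝ] C₀(ℕ, ℝ)}
    (hT : IsBirthDeathSemigroup (fun n => n + β) (fun n => n) T) : T = linearBirthDeath hβ :=
  (followsBesselFlow_linearBirthDeath hβ).eq_of_hasGenerator isExponentialFamily_geom
    (isFellerSemigroup_linearBirthDeath hβ).isContractionSemigroup
    hT.feller.isContractionSemigroup
    ((isBirthDeathSemigroup_iff_besselGenerator hβ hT.feller).1 hT)

theorem discreteBessel_eq_linearBirthDeath (hβ : 0 ≤ β) :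
    discreteBessel β = linearBirthDeath hβ := by
  have hex : ∃! T, IsBirthDeathSemigroup (fun n => n + β) (fun n => n) T :=
    ⟨_, isBirthDeathSemigroup_linearBirthDeath hβ, fun _ hT => hT.eq_linearBirthDeath hβ⟩
  rw [discreteBessel, dif_pos hex]
  exact hex.choose_spec.1.eq_linearBirthDeath hβ

end LinearBirthDeath

/-! ### Exponential functions in `C₀([0, ∞))` -/

section ExponentialFunctions

/-- A continuous function on `[0, ∞)` vanishing at infinity, as an element of `C₀([0, ∞))`. -/
def ofTendstoAtTop (f : ℝ≥0 → ℝ) (hf : Continuous f) (h : Tendsto f atTop (𝓝 0)) :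
    C₀(ℝ≥0, ℝ) where
  toFun := f
  continuous_toFun := hf
  zero_at_infty' := by rwa [cocompact_eq_atTop]

@[simp]
theorem ofTendstoAtTop_apply (f : ℝ≥0 → ℝ) (hf : Continuous f) (h : Tendsto f atTop (𝓝 0))
    (x : ℝ≥0) : ofTendstoAtTop f hf h x = f x := rfl

theorem tendsto_atTop_zero_nnreal (f : C₀(ℝ≥0, ℝ)) : Tendsto f atTop (𝓝 0) := by
  rw [← cocompact_eq_atTop]
  exact f.zero_at_infty'

variable {l : ℝ}

theorem tendsto_pow_mul_exp_neg_mul (hl : 0 < l) (k : ℕ) :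
    Tendsto (fun x : ℝ≥0 => (x : ℝ) ^ k * Real.exp (-(l * x))) atTop (𝓝 0) := by
  have hlx : Tendsto (fun x : ℝ≥0 => l * (x : ℝ)) atTop atTop :=
    (NNReal.tendsto_coe_atTop.2 tendsto_id).const_mul_atTop hl
  have h := ((Real.tendsto_pow_mul_exp_neg_atTop_nhds_zero k).comp hlx).const_mul (l ^ k)⁻¹
  rw [mul_zero] at h
  refine h.congr fun x => ?_
  rw [Function.comp_apply, mul_pow, mul_assoc, inv_mul_cancel_left₀ (by positivity)]

theorem tendsto_exp_neg_mul (hl : 0 < l) :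
    Tendsto (fun x : ℝ≥0 => Real.exp (-(l * x))) atTop (𝓝 0) := by
  simpa using tendsto_pow_mul_exp_neg_mul hl 0

open Classical in
/-- The exponential function `x ↦ e^{-l x}`, with the junk value `0` unless `l > 0`. -/
def expDecay (l : ℝ) : C₀(ℝ≥0, ℝ) :=
  if h : 0 < l then
    ofTendstoAtTop (fun x => Real.exp (-(l * x))) (by fun_prop) (tendsto_exp_neg_mul h)
  else 0

theorem expDecay_apply (hl : 0 < l) (x : ℝ≥0) : expDecay l x = Real.exp (-(l * x)) := by
  rw [expDecay, dif_pos hl, ofTendstoAtTop_apply]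

theorem dilation_expDecay (σ : ℝ≥0) (h0 : 0 < σ) (hl : 0 < l) :
    dilation σ h0 (expDecay l) = expDecay (σ * l) := by
  ext x
  rw [dilation_apply, expDecay_apply hl, expDecay_apply (mul_pos (NNReal.coe_pos.2 h0) hl),
    NNReal.coe_mul]
  congr 2
  ring

theorem poissonOperator_geom {w : ℝ} (hw : w ∈ Set.Ioo 0 1) :
    poissonOperator (geom w) = expDecay w := by
  ext x
  have h := (NormedSpace.expSeries_div_hasSum_exp ((x : ℝ) * (1 - w))).mul_left (Real.exp (-x))
  rw [← Real.exp_eq_exp_ℝ, ← Real.exp_add,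
    show -(x : ℝ) + x * (1 - w) = -(w * x) by ring] at h
  rw [poissonOperator_apply, expDecay_apply hw.1, ← h.tsum_eq]
  refine tsum_congr fun m => ?_
  rw [geom_apply hw, mul_pow]
  ring

/-- The function `x ↦ p(e^{-x})`, for a polynomial `p` without constant term. -/
def polyExp (p : Polynomial ℝ) : C₀(ℝ≥0, ℝ) := p.sum fun k c => c • expDecay k

theorem natCast_pos_of_mem_support {p : Polynomial ℝ} (hp : p.eval 0 = 0) {k : ℕ}
    (hk : k ∈ p.support) : (0 : ℝ) < k := by
  rw [← Polynomial.coeff_zero_eq_eval_zero] at hp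
  refine Nat.cast_pos.2 (Nat.pos_of_ne_zero fun h => Polynomial.mem_support_iff.1 hk ?_)
  rw [h, hp]

theorem polyExp_apply {p : Polynomial ℝ} (hp : p.eval 0 = 0) (x : ℝ≥0) :
    polyExp p x = p.eval (Real.exp (-x)) := by
  rw [polyExp, Polynomial.sum, sum_apply, Polynomial.eval_eq_sum, Polynomial.sum]
  refine Finset.sum_congr rfl fun k hk => ?_
  rw [ZeroAtInftyContinuousMap.smul_apply, smul_eq_mul,
    expDecay_apply (natCast_pos_of_mem_support hp hk), ← Real.exp_nat_mul, mul_neg]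

theorem polyExp_mem_span {p : Polynomial ℝ} (hp : p.eval 0 = 0) :
    polyExp p ∈ Submodule.span ℝ (expDecay '' Set.Ioi 0) :=
  Submodule.sum_mem _ fun k hk => Submodule.smul_mem _ _
    (Submodule.subset_span ⟨k, natCast_pos_of_mem_support hp hk, rfl⟩)

/-- The function `F` expressed in the variable `u = e^{-x}`, extended by `0` to `u ≤ 0`. -/
def logPullback (F : ℝ → ℝ) (u : ℝ) : ℝ := if 0 < u then F (-Real.log u) else 0

theorem logPullback_zero (F : ℝ → ℝ) : logPullback F 0 = 0 := if_neg (lt_irrefl 0)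

theorem logPullback_exp_neg (F : ℝ → ℝ) (x : ℝ) : logPullback F (Real.exp (-x)) = F x := by
  simp [logPullback, Real.exp_pos]

theorem continuous_logPullback (f : C₀(ℝ≥0, ℝ)) :
    Continuous (logPullback fun x => f x.toNNReal) := by
  refine continuous_iff_continuousAt.2 fun u => ?_
  rcases lt_trichotomy u 0 with hu | rfl | hu
  · refine continuousAt_const.congr (f := fun _ => 0) ?_
    filter_upwards [gt_mem_nhds hu] with v hv using (if_neg hv.not_gt).symm
  · have hlog : Tendsto (fun u : ℝ => (-Real.log u).toNNReal) (𝓝[>] 0) atTop :=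
      tendsto_real_toNNReal_atTop.comp
        (tendsto_neg_atBot_atTop.comp Real.tendsto_log_nhdsGT_zero)
    rw [ContinuousAt, logPullback_zero]
    suffices Tendsto (logPullback fun x => f x.toNNReal) (𝓝[≤] 0 ⊔ 𝓝[>] 0) (𝓝 0) by
      rwa [nhdsLE_sup_nhdsGT] at this
    refine tendsto_sup.2 ⟨?_, ?_⟩
    · refine tendsto_const_nhds.congr' ?_
      filter_upwards [self_mem_nhdsWithin] with v hv using (if_neg (not_lt.2 hv)).symm
    · refine ((tendsto_atTop_zero_nnreal f).comp hlog).congr' ?_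
      filter_upwards [self_mem_nhdsWithin] with v hv using (if_pos hv).symm
  · refine ContinuousAt.congr (f := fun u => f (-Real.log u).toNNReal) ?_ ?_
    · exact f.continuous.continuousAt.comp (continuous_real_toNNReal.continuousAt.comp
        (Real.continuousAt_log hu.ne').neg)
    · filter_upwards [lt_mem_nhds hu] with v hv using (if_pos hv).symm

theorem dense_span_expDecay :
    Dense (Submodule.span ℝ (expDecay '' Set.Ioi 0) : Set C₀(ℝ≥0, ℝ)) := by
  refine fun f => Metric.mem_closure_iff.2 fun ε hε => ?_
  obtain ⟨p, hp⟩ := exists_polynomial_near_of_continuousOn 0 1 _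
    (continuous_logPullback f).continuousOn (ε / 4) (by positivity)
  have hp0 := hp 0 ⟨le_rfl, zero_le_one⟩
  rw [logPullback_zero] at hp0
  have hq0 : (p - Polynomial.C (p.eval 0)).eval 0 = 0 := by simp
  refine ⟨_, polyExp_mem_span hq0, ?_⟩
  rw [dist_eq_norm]
  refine (norm_le_of_abs_le (half_pos hε).le fun x => ?_).trans_lt (half_lt_self hε)
  have hpx := hp (Real.exp (-x)) ⟨(Real.exp_pos _).le, Real.exp_le_one_iff.2 (by simp)⟩
  rw [logPullback_exp_neg, Real.toNNReal_coe] at hpx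
  rw [abs_lt] at hp0 hpx
  rw [ZeroAtInftyContinuousMap.sub_apply, polyExp_apply hq0, Polynomial.eval_sub,
    Polynomial.eval_C, abs_le]
  constructor <;> linarith

theorem sq_mul_exp_neg_mul_le (hl : 0 < l) (x : ℝ≥0) :
    (x : ℝ) ^ 2 * Real.exp (-(l * x)) ≤ 2 / l ^ 2 := by
  have h := Real.pow_div_factorial_le_exp (l * x) (by positivity) 2
  rw [Real.exp_neg, ← div_eq_mul_inv, div_le_div_iff₀ (Real.exp_pos _) (by positivity)]
  rw [div_le_iff₀ (by positivity), mul_pow] at h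
  simpa [mul_comm] using h

theorem hasDerivAt_expDecay (hl : 0 < l) :
    ∃ g, HasDerivAt expDecay g l ∧ ∀ x : ℝ≥0, g x = -(x * Real.exp (-(l * x))) := by
  have hnull : Tendsto (fun x : ℝ≥0 => -(x * Real.exp (-(l * x)))) atTop (𝓝 0) := by
    simpa using (tendsto_pow_mul_exp_neg_mul hl 1).neg
  have hexp : ∀ (x : ℝ≥0) (v : ℝ),
      HasDerivAt (fun v : ℝ => Real.exp (-(v * x))) (-(x * Real.exp (-(v * x)))) v := fun x v => by
    simpa [mul_comm] using ((hasDerivAt_id' v).mul_const (x : ℝ)).fun_neg.exp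
  refine ⟨ofTendstoAtTop _ (by fun_prop) hnull, hasDerivAt_of_bounded_second_deriv
    (C := 2 / (l / 2) ^ 2) (e₁ := fun v (x : ℝ≥0) => -(x * Real.exp (-(v * x))))
    (e₂ := fun v (x : ℝ≥0) => x ^ 2 * Real.exp (-(v * x))) (by positivity)
    ?_ ?_ ?_ fun x => rfl, fun x => rfl⟩
  · filter_upwards [lt_mem_nhds hl] with v hv x
    refine (hexp x v).congr_of_eventuallyEq ?_
    filter_upwards [lt_mem_nhds hv] with u hu using expDecay_apply hu x
  · refine Eventually.of_forall fun v x => ?_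
    exact ((hexp x v).const_mul (x : ℝ)).fun_neg.congr_deriv (by ring)
  · filter_upwards [lt_mem_nhds (half_lt_self hl)] with v hv x
    have hv0 : 0 < v := (half_pos hl).trans hv
    rw [abs_of_nonneg (by positivity)]
    exact (sq_mul_exp_neg_mul_le hv0 x).trans (by gcongr)

theorem deriv_expDecay_apply (hl : 0 < l) (x : ℝ≥0) :
    deriv expDecay l x = -(x * Real.exp (-(l * x))) := by
  obtain ⟨g, hg, hgx⟩ := hasDerivAt_expDecay hl
  rw [hg.deriv, hgx]

theorem isExponentialFamily_expDecay : IsExponentialFamily (Set.Ioi 0) expDecay where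
  pos _ hw := hw
  mem_nhdsGT := self_mem_nhdsWithin
  mem_of_le _ _ _ hv _ := hv
  nonneg _ hw x := by
    rw [expDecay_apply hw]
    positivity
  le_one l hl x := by
    have hl0 : 0 < l := hl
    rw [expDecay_apply hl, Real.exp_le_one_iff, neg_nonpos]
    positivity
  tendsto_one x := by
    have hcont : Continuous fun l : ℝ => Real.exp (-(l * x)) := by fun_prop
    refine ((hcont.tendsto' 0 1 (by simp)).mono_left nhdsWithin_le_nhds).congr' ?_
    filter_upwards [self_mem_nhdsWithin] with l hl using (expDecay_apply hl x).symm
  dense_span := dense_span_expDecay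
  differentiableAt _ hw := (hasDerivAt_expDecay hw).choose_spec.1.differentiableAt

end ExponentialFunctions

/-! ### The squared Bessel semigroup in closed form -/

section BesselFlow

open MeasureTheory ProbabilityTheory

open Classical in
/-- The gamma distribution with shape `a` and rate `1`, degenerate for `a = 0`. -/
def gammaLaw (a : ℝ) : Measure ℝ≥0 :=
  if 0 < a then (gammaMeasure a 1).map Real.toNNReal else Measure.dirac 0

instance isProbabilityMeasure_gammaLaw (a : ℝ) : IsProbabilityMeasure (gammaLaw a) := by
  unfold gammaLaw
  split_ifs with h
  · have := isProbabilityMeasure_gammaMeasure h one_pos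
    exact Measure.isProbabilityMeasure_map measurable_real_toNNReal.aemeasurable
  · infer_instance

variable {a l β : ℝ}

theorem gammaPDF_toReal_smul_exp (ha : 0 < a) (l y : ℝ) :
    (gammaPDF a 1 y).toReal • Real.exp (-(l * (y.toNNReal : ℝ)))
      = (Set.Ici 0).indicator
          (fun y => (Real.Gamma a)⁻¹ * (y ^ (a - 1) * Real.exp (-((1 + l) * y)))) y := by
  rw [gammaPDF, ENNReal.toReal_ofReal (gammaPDFReal_nonneg ha one_pos y), gammaPDFReal,
    Set.indicator_apply]
  simp only [Set.mem_Ici, Real.one_rpow]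
  split_ifs with hy
  · rw [Real.coe_toNNReal y hy, smul_eq_mul, add_mul, neg_add, Real.exp_add]
    ring
  · rw [zero_smul]

theorem integral_exp_neg_mul_gammaLaw (ha : 0 ≤ a) (hl : 0 < l) :
    ∫ y, Real.exp (-(l * y)) ∂gammaLaw a = (1 + l) ^ (-a) := by
  unfold gammaLaw
  split_ifs with h
  · have hpdf : Measurable (gammaPDF a 1) := (measurable_gammaPDFReal a 1).ennreal_ofReal
    rw [integral_map measurable_real_toNNReal.aemeasurable
      (by fun_prop : Continuous fun y : ℝ≥0 => Real.exp (-(l * y))).aestronglyMeasurable,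
      gammaMeasure, integral_withDensity_eq_integral_toReal_smul hpdf
        (Eventually.of_forall fun _ => ENNReal.ofReal_lt_top)]
    simp only [gammaPDF_toReal_smul_exp h]
    rw [integral_indicator measurableSet_Ici, integral_Ici_eq_integral_Ioi,
      integral_const_mul, Real.integral_rpow_mul_exp_neg_mul_Ioi h (by positivity), mul_left_comm,
      inv_mul_cancel₀ (Real.Gamma_pos_of_pos h).ne', mul_one, one_div,
      Real.inv_rpow (by positivity), Real.rpow_neg (by positivity)]
  · obtain rfl : a = 0 := le_antisymm (not_lt.1 h) ha
    simp

/-- The expectation with respect to a probability measure on `[0, ∞)`, as a functional. -/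
def expectation (μ : Measure ℝ≥0) [IsProbabilityMeasure μ] : C₀(ℝ≥0, ℝ) →L[ℝ] ℝ :=
  LinearMap.mkContinuous
    { toFun := fun f => ∫ y, f y ∂μ
      map_add' := fun f g => integral_add (f.toBCF.integrable μ) (g.toBCF.integrable μ)
      map_smul' := fun c f => integral_const_mul c _ } 1
    (fun f => by
      simpa using norm_integral_le_of_norm_le_const (μ := μ) (f := f) (C := ‖f‖)
        (Eventually.of_forall fun y => abs_apply_le_norm f y))

theorem expectation_apply (μ : Measure ℝ≥0) [IsProbabilityMeasure μ] (f : C₀(ℝ≥0, ℝ)) :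
    expectation μ f = ∫ y, f y ∂μ := rfl

theorem norm_expectation_le (μ : Measure ℝ≥0) [IsProbabilityMeasure μ] : ‖expectation μ‖ ≤ 1 :=
  LinearMap.mkContinuous_norm_le _ zero_le_one _

theorem expectation_gammaLaw_expDecay (ha : 0 ≤ a) (hl : 0 < l) :
    expectation (gammaLaw a) (expDecay l) = (1 + l) ^ (-a) := by
  rw [expectation_apply, ← integral_exp_neg_mul_gammaLaw ha hl]
  simp only [expDecay_apply hl]

theorem expectation_gammaLaw_natCast_add_expDecay (hβ : 0 ≤ β) (hl : 0 < l) (n : ℕ) :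
    expectation (gammaLaw (n + β)) (expDecay l) = (1 + l) ^ (-β) * (1 + l)⁻¹ ^ n := by
  rw [expectation_gammaLaw_expDecay (by positivity) hl, neg_add_rev, Real.rpow_add (by positivity),
    Real.rpow_neg (by positivity) (n : ℝ), Real.rpow_natCast, inv_pow]

theorem tendsto_expectation_gammaLaw (hβ : 0 ≤ β) (f : C₀(ℝ≥0, ℝ)) :
    Tendsto (fun n : ℕ => expectation (gammaLaw (n + β)) f) atTop (𝓝 0) := by
  refine tendsto_apply_of_dense_span (B := 0) (fun n => norm_expectation_le _)
    dense_span_expDecay ?_ f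
  rintro _ ⟨l, hl, rfl⟩
  have hl0 : 0 < l := hl
  simp only [expectation_gammaLaw_natCast_add_expDecay hβ hl0]
  simpa using (tendsto_pow_atTop_nhds_zero_of_lt_one (by positivity)
    (inv_lt_one_of_one_lt₀ (lt_add_of_pos_right 1 hl0))).const_mul ((1 + l) ^ (-β))

/-- The operator `f ↦ (n ↦ 𝔼[f(Γ_{n + β})])` from `C₀([0, ∞))` to `c₀(ℤ₊)`. -/
def gammaOperator (hβ : 0 ≤ β) : C₀(ℝ≥0, ℝ) →L[ℝ] C₀(ℕ, ℝ) :=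
  LinearMap.mkContinuous
    { toFun := fun f => ofNullSequence _ (tendsto_expectation_gammaLaw hβ f)
      map_add' := fun f g => ZeroAtInftyContinuousMap.ext fun n =>
        map_add (expectation (gammaLaw (n + β))) f g
      map_smul' := fun c f => ZeroAtInftyContinuousMap.ext fun n =>
        map_smul (expectation (gammaLaw (n + β))) c f } 1
    (fun f => (one_mul ‖f‖).symm ▸ norm_le_of_abs_le (norm_nonneg f) fun _ =>
      norm_apply_le_of_norm_le_one (norm_expectation_le _) f)

theorem isPositiveContraction_gammaOperator (hβ : 0 ≤ β) :
    IsPositiveContraction (gammaOperator hβ) where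
  nonneg _ hf _ := integral_nonneg hf
  norm_le := LinearMap.mkContinuous_norm_le _ zero_le_one _

theorem div_one_add_mem_Ioo (hl : 0 < l) : l / (1 + l) ∈ Set.Ioo 0 1 :=
  ⟨by positivity, (div_lt_one (by positivity)).2 (lt_one_add l)⟩

theorem gammaOperator_expDecay (hβ : 0 ≤ β) (hl : 0 < l) :
    gammaOperator hβ (expDecay l) = (1 + l) ^ (-β) • geom (l / (1 + l)) := by
  ext n
  have hcompl : 1 - l / (1 + l) = (1 + l)⁻¹ := by
    field_simp
    ring
  rw [ZeroAtInftyContinuousMap.smul_apply, geom_apply (div_one_add_mem_Ioo hl), hcompl]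
  exact expectation_gammaLaw_natCast_add_expDecay hβ hl n

open Classical in
/-- The squared Bessel semigroup: at time `t > 0` and started at `x`, the process has the law of
`t Γ_{N + β}`, where `N` is Poisson of parameter `x / t`. -/
def besselFlow (hβ : 0 ≤ β) (t : ℝ≥0) : C₀(ℝ≥0, ℝ) →L[ℝ] C₀(ℝ≥0, ℝ) :=
  if ht : 0 < t then
    (dilation t⁻¹ (inv_pos.2 ht)).comp
      (poissonOperator.comp ((gammaOperator hβ).comp (dilation t ht)))
  else ContinuousLinearMap.id ℝ _

theorem isPositiveContraction_besselFlow (hβ : 0 ≤ β) (t : ℝ≥0) :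
    IsPositiveContraction (besselFlow hβ t) := by
  unfold besselFlow
  split_ifs with ht
  · exact (isPositiveContraction_dilation _).comp ((isPositiveContraction_kernelOperator _).comp
      ((isPositiveContraction_gammaOperator hβ).comp (isPositiveContraction_dilation _)))
  · exact ⟨fun f hf => hf, ContinuousLinearMap.norm_id_le⟩

theorem followsBesselFlow_besselFlow (hβ : 0 ≤ β) :
    FollowsBesselFlow β (Set.Ioi 0) expDecay (besselFlow hβ) := by
  intro t l hl
  have hl0 : 0 < l := hl
  rcases eq_zero_or_pos t with rfl | ht
  · simp [besselFlow]
  · have ht0 : (0 : ℝ) < t := ht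
    have htl : 0 < t * l := by positivity
    rw [besselFlow, dif_pos ht]
    simp only [ContinuousLinearMap.comp_apply]
    rw [dilation_expDecay t ht hl, gammaOperator_expDecay hβ htl, map_smul, map_smul,
      poissonOperator_geom (div_one_add_mem_Ioo htl), dilation_expDecay _ _ (by positivity),
      NNReal.coe_inv, mul_div_assoc, inv_mul_cancel_left₀ ht0.ne']

theorem isFellerSemigroup_besselFlow (hβ : 0 ≤ β) : IsFellerSemigroup (besselFlow hβ) :=
  (followsBesselFlow_besselFlow hβ).isFellerSemigroup isExponentialFamily_expDecay
    (isPositiveContraction_besselFlow hβ)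

end BesselFlow

/-! ### Weierstrass approximation in `C²([0, 1])` -/

section Weierstrass

theorem exists_polynomial_antiderivative (q : Polynomial ℝ) (c : ℝ) :
    ∃ r : Polynomial ℝ, r.derivative = q ∧ r.eval 0 = c := by
  suffices ∃ r : Polynomial ℝ, r.derivative = q ∧ r.eval 0 = 0 by
    obtain ⟨r, hr, hr0⟩ := this
    exact ⟨r + Polynomial.C c, by simp [hr], by simp [hr0]⟩
  induction q using Polynomial.induction_on' with
  | add p q hp hq =>
    obtain ⟨r, hr, hr0⟩ := hp
    obtain ⟨r', hr', hr0'⟩ := hq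
    exact ⟨r + r', by rw [Polynomial.derivative_add, hr, hr'], by simp [hr0, hr0']⟩
  | monomial n a =>
    refine ⟨Polynomial.monomial (n + 1) (a / (n + 1)), ?_, by simp⟩
    rw [Polynomial.derivative_monomial, Nat.add_sub_cancel, Nat.cast_succ,
      div_mul_cancel₀ a n.cast_add_one_ne_zero]

theorem abs_sub_le_of_abs_deriv_sub_le {f g : ℝ → ℝ} {ε : ℝ} (hf : Differentiable ℝ f)
    (hg : Differentiable ℝ g) (h0 : f 0 = g 0)
    (h : ∀ u ∈ Set.Icc (0 : ℝ) 1, |deriv f u - deriv g u| ≤ ε) :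
    ∀ u ∈ Set.Icc (0 : ℝ) 1, |f u - g u| ≤ ε := by
  intro u hu
  have hmean := (convex_Icc (0 : ℝ) 1).norm_image_sub_le_of_norm_deriv_le
    (f := fun v => f v - g v) (fun v _ => (hf v).fun_sub (hg v))
    (fun v hv => by rw [deriv_fun_sub (hf v) (hg v)]; exact h v hv)
    (Set.left_mem_Icc.2 zero_le_one) hu
  rw [h0, sub_self, sub_zero, sub_zero, Real.norm_of_nonneg hu.1] at hmean
  exact hmean.trans (mul_le_of_le_one_right ((abs_nonneg _).trans (h u hu)) hu.2)

theorem exists_polynomial_near_of_contDiff {φ : ℝ → ℝ} (hφ : ContDiff ℝ 2 φ) {ε : ℝ}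
    (hε : 0 < ε) :
    ∃ p : Polynomial ℝ, p.eval 0 = φ 0 ∧ ∀ u ∈ Set.Icc (0 : ℝ) 1, |p.eval u - φ u| ≤ ε ∧
      |p.derivative.eval u - deriv φ u| ≤ ε ∧
      |p.derivative.derivative.eval u - deriv (deriv φ) u| ≤ ε := by
  have hφ1 : ContDiff ℝ 1 (deriv φ) := hφ.deriv'
  obtain ⟨q, hq⟩ := exists_polynomial_near_of_continuousOn 0 1 _
    (hφ1.continuous_deriv le_rfl).continuousOn ε hε
  obtain ⟨r, rfl, hr0⟩ := exists_polynomial_antiderivative q (deriv φ 0)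
  obtain ⟨p, rfl, hp0⟩ := exists_polynomial_antiderivative r (φ 0)
  have h1 := abs_sub_le_of_abs_deriv_sub_le p.derivative.differentiable
    (hφ1.differentiable one_ne_zero) hr0
    fun u hu => by simpa only [Polynomial.deriv] using (hq u hu).le
  have h0 := abs_sub_le_of_abs_deriv_sub_le p.differentiable (hφ.differentiable two_ne_zero) hp0
    fun u hu => by simpa only [Polynomial.deriv] using h1 u hu
  exact ⟨p, hp0, fun u hu => ⟨h0 u hu, h1 u hu, (hq u hu).le⟩⟩

theorem contDiff_logPullback {n : WithTop ℕ∞} {F : ℝ → ℝ} (hF : ContDiff ℝ n F)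
    (hs : HasCompactSupport F) : ContDiff ℝ n (logPullback F) := by
  refine contDiff_iff_contDiffAt.2 fun u => ?_
  rcases lt_or_ge 0 u with hu | hu
  · refine ContDiffAt.congr_of_eventuallyEq (f := fun u => F (-Real.log u)) ?_ ?_
    · exact hF.contDiffAt.comp u (Real.contDiffAt_log.2 hu.ne').neg
    · filter_upwards [lt_mem_nhds hu] with v hv using if_pos hv
  · obtain ⟨M, hM⟩ := hs.isCompact.bddAbove
    refine contDiffAt_const.congr_of_eventuallyEq (f := fun _ => 0) ?_
    filter_upwards [gt_mem_nhds (hu.trans_lt (Real.exp_pos (-M)))] with v hv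
    rw [logPullback, ite_eq_right_iff]
    intro hv0
    have hlog : Real.log v < -M := (Real.log_lt_iff_lt_exp hv0).2 hv
    exact image_eq_zero_of_notMem_tsupport fun h => (hM h).not_gt (lt_neg_of_lt_neg hlog)

end Weierstrass

/-! ### The operator `x ∂² + β ∂` -/

section BesselOperator

variable {β : ℝ} {F H : ℝ → ℝ} {f g : C₀(ℝ≥0, ℝ)} {T : ℝ≥0 → C₀(ℝ≥0, ℝ) →L[ℝ] C₀(ℝ≥0, ℝ)}

/-- The restriction of `F` to `[0, ∞)` and its image under `x ∂² + β ∂` are the elements `f` and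
`g` of `C₀([0, ∞))`. -/
structure IsBesselPair (β : ℝ) (F : ℝ → ℝ) (f g : C₀(ℝ≥0, ℝ)) : Prop where
  apply_eq : ∀ x : ℝ≥0, f x = F x
  image_eq : ∀ x : ℝ≥0, g x = x * deriv (deriv F) x + β * deriv F x

/-- `H` is `η`-close to `F` on `[0, ∞)` in a weighted `C²` norm that controls `x ∂² + β ∂`. -/
def IsBesselClose (η : ℝ) (F H : ℝ → ℝ) : Prop :=
  ∀ x : ℝ≥0, |H x - F x| ≤ η ∧ |deriv H x - deriv F x| ≤ η ∧
    x * |deriv (deriv H) x - deriv (deriv F) x| ≤ η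

theorem exists_zeroAtInfty_eq (hF : Continuous F) (hs : HasCompactSupport F) :
    ∃ f : C₀(ℝ≥0, ℝ), ∀ x, f x = F x := by
  have hs' : HasCompactSupport fun x : ℝ≥0 => F x :=
    hs.comp_isClosedEmbedding isClosed_Ici.isClosedEmbedding_subtypeVal
  exact ⟨⟨⟨fun x => F x, by fun_prop⟩, hs'.is_zero_at_infty⟩, fun _ => rfl⟩

theorem exists_isBesselPair (β : ℝ) (hF : ContDiff ℝ ∞ F) (hs : HasCompactSupport F) :
    ∃ f g, IsBesselPair β F f g := by
  have hF' : ContDiff ℝ ∞ (deriv F) := (contDiff_infty_iff_deriv.1 hF).2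
  have hF'' : ContDiff ℝ ∞ (deriv (deriv F)) := (contDiff_infty_iff_deriv.1 hF').2
  have hcont : Continuous fun x => x * deriv (deriv F) x + β * deriv F x :=
    (continuous_id.mul hF''.continuous).add (continuous_const.mul hF'.continuous)
  obtain ⟨f, hf⟩ := exists_zeroAtInfty_eq hF.continuous hs
  obtain ⟨g, hg⟩ := exists_zeroAtInfty_eq hcont (hs.deriv.deriv.mul_left.add hs.deriv.mul_left)
  exact ⟨f, g, hf, hg⟩

theorem IsBesselPair.hasGenerator_of_close (hT : IsContractionSemigroup T)
    (hF : IsBesselPair β F f g)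
    (h : ∀ η > 0, ∃ H f' g', HasGenerator T f' g' ∧ IsBesselPair β H f' g' ∧
      IsBesselClose η F H) : HasGenerator T f g := by
  refine hT.hasGenerator_of_approx fun ε hε => ?_
  obtain ⟨H, f', g', hgen, hH, hclose⟩ := h (ε / (1 + |β|)) (by positivity)
  refine ⟨f', g', hgen, norm_le_of_abs_le hε.le fun x => ?_, norm_le_of_abs_le hε.le fun x => ?_⟩
  · rw [ZeroAtInftyContinuousMap.sub_apply, hH.apply_eq, hF.apply_eq]
    exact (hclose x).1.trans (div_le_self hε.le (le_add_of_nonneg_right (abs_nonneg β)))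
  · obtain ⟨-, h1, h2⟩ := hclose x
    calc |(g' - g) x|
        = |x * (deriv (deriv H) x - deriv (deriv F) x) + β * (deriv H x - deriv F x)| := by
          rw [ZeroAtInftyContinuousMap.sub_apply, hH.image_eq, hF.image_eq]
          ring_nf
      _ ≤ x * |deriv (deriv H) x - deriv (deriv F) x| + |β| * |deriv H x - deriv F x| := by
          refine (abs_add_le _ _).trans_eq ?_
          rw [abs_mul, abs_mul, abs_of_nonneg x.coe_nonneg]
      _ ≤ ε / (1 + |β|) + |β| * (ε / (1 + |β|)) := by gcongr
      _ = ε := by field_simp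

theorem deriv_sum_mul_exp {ι : Type*} (s : Finset ι) (c l : ι → ℝ) :
    deriv (fun x => ∑ i ∈ s, c i * Real.exp (-(l i * x)))
      = fun x => ∑ i ∈ s, -(l i) * c i * Real.exp (-(l i * x)) := by
  funext x
  refine (HasDerivAt.fun_sum fun i _ => ?_).deriv
  exact (((hasDerivAt_id' x).const_mul (l i)).fun_neg.exp.const_mul (c i)).congr_deriv (by ring)

theorem besselGenerator_expDecay_apply (β : ℝ) {l : ℝ} (hl : 0 < l) (x : ℝ≥0) :
    besselGenerator β expDecay l x = (l ^ 2 * x - β * l) * Real.exp (-(l * x)) := by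
  simp only [besselGenerator, ZeroAtInftyContinuousMap.add_apply,
    ZeroAtInftyContinuousMap.smul_apply, smul_eq_mul, expDecay_apply hl, deriv_expDecay_apply hl]
  ring

theorem isBesselPair_sum_exp {ι : Type*} (β : ℝ) (s : Finset ι) (c : ι → ℝ) {l : ι → ℝ}
    (hl : ∀ i ∈ s, 0 < l i) :
    IsBesselPair β (fun x => ∑ i ∈ s, c i * Real.exp (-(l i * x))) (∑ i ∈ s, c i • expDecay (l i))
      (∑ i ∈ s, c i • besselGenerator β expDecay (l i)) where
  apply_eq x := by
    rw [sum_apply]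
    refine Finset.sum_congr rfl fun i hi => ?_
    rw [ZeroAtInftyContinuousMap.smul_apply, smul_eq_mul, expDecay_apply (hl i hi)]
  image_eq x := by
    rw [deriv_sum_mul_exp, deriv_sum_mul_exp, sum_apply, Finset.mul_sum, Finset.mul_sum,
      ← Finset.sum_add_distrib]
    refine Finset.sum_congr rfl fun i hi => ?_
    rw [ZeroAtInftyContinuousMap.smul_apply, smul_eq_mul,
      besselGenerator_expDecay_apply β (hl i hi)]
    ring

theorem isBesselPair_exp (β : ℝ) {l : ℝ} (hl : 0 < l) :
    IsBesselPair β (fun x => Real.exp (-(l * x))) (expDecay l) (besselGenerator β expDecay l) := by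
  simpa using isBesselPair_sum_exp (ι := Unit) β {()} (fun _ => 1) (l := fun _ => l) fun _ _ => hl

theorem isBesselPair_polyExp (β : ℝ) {p : Polynomial ℝ} (hp : p.eval 0 = 0) :
    IsBesselPair β (fun x => p.eval (Real.exp (-x))) (polyExp p)
      (p.sum fun k c => c • besselGenerator β expDecay k) := by
  have hsum := isBesselPair_sum_exp β p.support p.coeff (l := fun k => (k : ℝ))
    fun _ => natCast_pos_of_mem_support hp
  have heval : (fun x : ℝ => p.eval (Real.exp (-x)))
      = fun x => ∑ k ∈ p.support, p.coeff k * Real.exp (-(k * x)) := by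
    funext x
    rw [Polynomial.eval_eq_sum, Polynomial.sum]
    simp only [← Real.exp_nat_mul, mul_neg]
  rwa [heval]

theorem deriv_comp_exp_neg {φ : ℝ → ℝ} (hφ : Differentiable ℝ φ) :
    deriv (fun x => φ (Real.exp (-x))) = fun x => -(Real.exp (-x) * deriv φ (Real.exp (-x))) := by
  funext x
  have hexp : HasDerivAt (fun x => Real.exp (-x)) (-Real.exp (-x)) x := by
    simpa using (hasDerivAt_neg' x).exp
  exact ((hφ _).hasDerivAt.comp x hexp).deriv.trans (by ring)

theorem deriv_deriv_comp_exp_neg {φ : ℝ → ℝ} (hφ : ContDiff ℝ 2 φ) :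
    deriv (deriv fun x => φ (Real.exp (-x))) = fun x =>
      Real.exp (-x) * deriv φ (Real.exp (-x))
        + Real.exp (-x) ^ 2 * deriv (deriv φ) (Real.exp (-x)) := by
  have hφ' : Differentiable ℝ (deriv φ) := hφ.differentiable_deriv_two
  rw [deriv_comp_exp_neg (hφ.differentiable two_ne_zero),
    deriv_comp_exp_neg (φ := fun u => -(u * deriv φ u)) (by fun_prop)]
  funext x
  rw [deriv.fun_neg, deriv_fun_mul differentiableAt_fun_id (hφ' _), deriv_id'']
  ring

theorem isBesselClose_comp_exp_neg {φ ψ : ℝ → ℝ} {ε : ℝ} (hφ : ContDiff ℝ 2 φ)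
    (hψ : ContDiff ℝ 2 ψ)
    (h : ∀ u ∈ Set.Icc (0 : ℝ) 1, |ψ u - φ u| ≤ ε ∧ |deriv ψ u - deriv φ u| ≤ ε ∧
      |deriv (deriv ψ) u - deriv (deriv φ) u| ≤ ε) :
    IsBesselClose (2 * ε) (fun x => φ (Real.exp (-x))) fun x => ψ (Real.exp (-x)) := by
  intro x
  rw [deriv_deriv_comp_exp_neg hφ, deriv_deriv_comp_exp_neg hψ,
    deriv_comp_exp_neg (hφ.differentiable two_ne_zero),
    deriv_comp_exp_neg (hψ.differentiable two_ne_zero)]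
  beta_reduce
  have hxu : x * Real.exp (-x) ≤ 1 := by
    rw [Real.exp_neg, ← div_eq_mul_inv, div_le_one (Real.exp_pos x)]
    exact (le_add_of_nonneg_right zero_le_one).trans (Real.add_one_le_exp x)
  have hu1 : Real.exp (-x) ≤ 1 := Real.exp_le_one_iff.2 (neg_nonpos.2 x.coe_nonneg)
  have hu0 := Real.exp_pos (-x)
  generalize Real.exp (-(x : ℝ)) = u at *
  obtain ⟨h0, h1, h2⟩ := h u ⟨hu0.le, hu1⟩
  have hε : 0 ≤ ε := (abs_nonneg _).trans h0
  refine ⟨h0.trans (le_mul_of_one_le_left hε one_le_two), ?_, ?_⟩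
  · rw [neg_sub_neg, abs_sub_comm, ← mul_sub, abs_mul, abs_of_pos hu0]
    calc u * |deriv ψ u - deriv φ u| ≤ 1 * ε := by gcongr
      _ ≤ 2 * ε := by gcongr; exact one_le_two
  · calc x * |u * deriv ψ u + u ^ 2 * deriv (deriv ψ) u
          - (u * deriv φ u + u ^ 2 * deriv (deriv φ) u)|
        = x * |u * (deriv ψ u - deriv φ u) + u ^ 2 * (deriv (deriv ψ) u - deriv (deriv φ) u)| := by
          ring_nf
      _ ≤ x * (u * ε + u ^ 2 * ε) := by
          gcongr
          refine (abs_add_le _ _).trans ?_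
          rw [abs_mul, abs_mul, abs_of_pos hu0, abs_of_pos (pow_pos hu0 2)]
          gcongr
      _ = x * u * (1 + u) * ε := by ring
      _ ≤ 1 * (1 + 1) * ε := by gcongr
      _ = 2 * ε := by ring

theorem exists_polyExp_isBesselClose {F : ℝ → ℝ} (hF : ContDiff ℝ 2 F) (hs : HasCompactSupport F)
    {η : ℝ} (hη : 0 < η) :
    ∃ p : Polynomial ℝ, p.eval 0 = 0 ∧ IsBesselClose η F fun x => p.eval (Real.exp (-x)) := by
  have hφ := contDiff_logPullback hF hs
  obtain ⟨p, hp0, hp⟩ := exists_polynomial_near_of_contDiff hφ (half_pos hη)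
  have hpderiv : deriv (fun u => p.eval u) = fun u => p.derivative.eval u :=
    funext fun _ => p.deriv
  refine ⟨p, by rw [hp0, logPullback_zero], ?_⟩
  have hclose := isBesselClose_comp_exp_neg hφ (ψ := fun u => p.eval u) (p.contDiff_aeval 2)
    fun u hu => by simpa only [hpderiv, Polynomial.deriv] using hp u hu
  simpa only [logPullback_exp_neg, mul_div_cancel₀ η two_ne_zero] using! hclose

theorem hasGenerator_besselFlow (hβ : 0 ≤ β) (hF : ContDiff ℝ 2 F) (hs : HasCompactSupport F)
    (hfg : IsBesselPair β F f g) : HasGenerator (besselFlow hβ) f g := by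
  refine hfg.hasGenerator_of_close (isFellerSemigroup_besselFlow hβ).isContractionSemigroup
    fun η hη => ?_
  obtain ⟨p, hp0, hp⟩ := exists_polyExp_isBesselClose hF hs hη
  refine ⟨_, _, _, HasGenerator.sum _ fun k hk => ?_, isBesselPair_polyExp β hp0, hp⟩
  exact ((followsBesselFlow_besselFlow hβ).hasGenerator isExponentialFamily_expDecay
    (natCast_pos_of_mem_support hp0 hk)).smul _

theorem isSquaredBesselSemigroup_besselFlow (hβ : 0 ≤ β) :
    IsSquaredBesselSemigroup β (besselFlow hβ) where
  feller := isFellerSemigroup_besselFlow hβ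
  generator F f hF hs hf := by
    obtain ⟨_, g, _, hg⟩ := exists_isBesselPair β hF hs
    exact (generatorMapsTo_iff hg).2
      (hasGenerator_besselFlow hβ (contDiff_infty.1 hF 2) hs ⟨hf, hg⟩)

end BesselOperator

/-! ### Uniqueness of the squared Bessel semigroup -/

section BesselUniqueness

variable {β l R C η : ℝ} {χ : ℝ → ℝ}

/-- A smooth cutoff function for the interval `[-R, R]`, with derivatives bounded by `C`. -/
structure IsCutoff (C R : ℝ) (χ : ℝ → ℝ) : Prop where
  contDiff : ContDiff ℝ ∞ χ
  hasCompactSupport : HasCompactSupport χ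
  eventuallyEq_one : ∀ x, |x| < R → χ =ᶠ[𝓝 x] 1
  bound : ∀ x, |χ x - 1| ≤ C ∧ |deriv χ x| ≤ C ∧ |deriv (deriv χ) x| ≤ C

theorem exists_isCutoff_one : ∃ C χ, IsCutoff C 1 χ := by
  let χ : ContDiffBump (0 : ℝ) := ⟨1, 2, one_pos, one_lt_two⟩
  have hχ : ContDiff ℝ ∞ χ := χ.contDiff
  have hχ' : ContDiff ℝ ∞ (deriv χ) := (contDiff_infty_iff_deriv.1 hχ).2
  obtain ⟨C₁, h₁⟩ := χ.hasCompactSupport.deriv.exists_bound_of_continuous hχ'.continuous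
  obtain ⟨C₂, h₂⟩ := χ.hasCompactSupport.deriv.deriv.exists_bound_of_continuous
    (hχ'.continuous_deriv (by simp))
  refine ⟨max 1 (max C₁ C₂), χ, hχ, χ.hasCompactSupport, fun x hx => ?_, fun x => ⟨?_, ?_, ?_⟩⟩
  · exact χ.eventuallyEq_one_of_mem_ball (by simpa using hx)
  · exact (abs_sub_le_of_nonneg_of_le χ.nonneg χ.le_one zero_le_one le_rfl).trans
      (le_max_left _ _)
  · exact (h₁ x).trans ((le_max_left _ _).trans (le_max_right _ _))
  · exact (h₂ x).trans ((le_max_right _ _).trans (le_max_right _ _))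

theorem IsCutoff.scale (h : IsCutoff C 1 χ) (hR : 1 ≤ R) : IsCutoff C R fun x => χ (R⁻¹ * x) := by
  have hR0 : 0 < R := zero_lt_one.trans_le hR
  have hs0 : 0 < R⁻¹ := inv_pos.2 hR0
  have hs1 : R⁻¹ ≤ 1 := inv_le_one_of_one_le₀ hR
  have hderiv : deriv (fun x => χ (R⁻¹ * x)) = fun x => R⁻¹ * deriv χ (R⁻¹ * x) :=
    funext fun x => deriv_comp_mul_left R⁻¹ χ x
  have hderiv2 : deriv (fun x => R⁻¹ * deriv χ (R⁻¹ * x))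
      = fun x => R⁻¹ * (R⁻¹ * deriv (deriv χ) (R⁻¹ * x)) := by
    funext x
    rw [deriv_const_mul_field, deriv_comp_mul_left, smul_eq_mul]
  have shrink : ∀ {y : ℝ}, |y| ≤ C → |R⁻¹ * y| ≤ C := fun hy => by
    rw [abs_mul, abs_of_pos hs0]
    exact (mul_le_of_le_one_left (abs_nonneg _) hs1).trans hy
  refine ⟨h.contDiff.comp (by fun_prop), h.hasCompactSupport.comp_homeomorph
    (Homeomorph.mulLeft₀ R⁻¹ hs0.ne'), fun x hx => ?_, fun x => ?_⟩
  · have hx1 : |R⁻¹ * x| < 1 := by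
      rwa [abs_mul, abs_of_pos hs0, inv_mul_lt_one₀ hR0]
    have hcont : Tendsto (fun y => R⁻¹ * y) (𝓝 x) (𝓝 (R⁻¹ * x)) :=
      (continuous_const_mul R⁻¹).tendsto x
    exact hcont.eventually (h.eventuallyEq_one _ hx1)
  · obtain ⟨h0, h1, h2⟩ := h.bound (R⁻¹ * x)
    rw [hderiv, hderiv2]
    exact ⟨h0, shrink h1, shrink (shrink h2)⟩

theorem deriv_exp_neg_mul_mul (hχ : Differentiable ℝ χ) (l : ℝ) :
    deriv (fun x => Real.exp (-(l * x)) * χ x)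
      = fun x => Real.exp (-(l * x)) * (deriv χ x - l * χ x) := by
  funext x
  have hexp : HasDerivAt (fun x => Real.exp (-(l * x))) (Real.exp (-(l * x)) * -(l * 1)) x :=
    ((hasDerivAt_id' x).const_mul l).fun_neg.exp
  exact (hexp.mul (hχ x).hasDerivAt).deriv.trans (by ring)

theorem deriv_deriv_exp_neg_mul_mul (hχ : ContDiff ℝ 2 χ) (l : ℝ) :
    deriv (deriv fun x => Real.exp (-(l * x)) * χ x)
      = fun x => Real.exp (-(l * x)) * (deriv (deriv χ) x - 2 * l * deriv χ x + l ^ 2 * χ x) := by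
  have hχ0 : Differentiable ℝ χ := hχ.differentiable two_ne_zero
  have hχ1 : Differentiable ℝ (deriv χ) := hχ.differentiable_deriv_two
  rw [deriv_exp_neg_mul_mul hχ0, deriv_exp_neg_mul_mul (by fun_prop)]
  funext x
  rw [deriv_fun_sub (hχ1 x) ((hχ0 x).const_mul l), deriv_const_mul_field]
  ring

theorem abs_sub_mul_le {a b d : ℝ} (hl : 0 ≤ l) (ha : |a| ≤ d) (hb : |b| ≤ d) :
    |b - l * a| ≤ (1 + l) * d := by
  have hla : |l * a| ≤ l * d := by
    rw [abs_mul, abs_of_nonneg hl]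
    gcongr
  linarith [abs_sub b (l * a)]

theorem isBesselClose_exp_mul (hl : 0 < l) (hχ : ContDiff ℝ 2 χ)
    (h : ∀ x : ℝ≥0, ∃ d, |χ x - 1| ≤ d ∧ |deriv χ x| ≤ d ∧ |deriv (deriv χ) x| ≤ d ∧
      (1 + l) ^ 2 * (1 + x) * Real.exp (-(l * x)) * d ≤ η) :
    IsBesselClose η (fun x => Real.exp (-(l * x))) fun x => Real.exp (-(l * x)) * χ x := by
  have hone := deriv_exp_neg_mul_mul (differentiable_const (1 : ℝ)) l
  have hone2 := deriv_deriv_exp_neg_mul_mul (contDiff_const (c := (1 : ℝ))) l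
  simp only [mul_one, deriv_const', zero_sub, mul_zero, sub_zero, zero_add] at hone hone2
  intro x
  obtain ⟨d, h0, h1, h2, hd⟩ := h x
  rw [deriv_deriv_exp_neg_mul_mul hχ, deriv_exp_neg_mul_mul (hχ.differentiable two_ne_zero),
    hone2, hone]
  beta_reduce
  have hx := x.coe_nonneg
  have hd0 : 0 ≤ d := (abs_nonneg _).trans h0
  have hE := Real.exp_pos (-(l * x))
  generalize Real.exp (-(l * (x : ℝ))) = E at *
  have weight : ∀ {z M : ℝ}, z ≤ M * d → M ≤ (1 + l) ^ 2 * (1 + x) → E * z ≤ η := by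
    intro z M hz hM
    calc E * z ≤ E * ((1 + l) ^ 2 * (1 + x) * d) := by gcongr; exact hz.trans (by gcongr)
      _ = (1 + l) ^ 2 * (1 + x) * E * d := by ring
      _ ≤ η := hd
  have hlx : 0 ≤ (1 + l) ^ 2 * x := by positivity
  have h01 := abs_sub_mul_le hl.le h0 h1
  have h012 := abs_sub_mul_le hl.le h01 (abs_sub_mul_le hl.le h1 h2)
  refine ⟨?_, ?_, ?_⟩
  · rw [← mul_sub_one, abs_mul, abs_of_pos hE]
    exact weight (h0.trans_eq (one_mul d).symm) (by nlinarith)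
  · rw [← mul_sub, abs_mul, abs_of_pos hE, sub_neg_eq_add, sub_add, ← mul_sub_one]
    exact weight h01 (by nlinarith)
  · calc x * |E * (deriv (deriv χ) x - 2 * l * deriv χ x + l ^ 2 * χ x) - E * l ^ 2|
        = E * (x * |deriv (deriv χ) x - l * deriv χ x - l * (deriv χ x - l * (χ x - 1))|) := by
          rw [← mul_sub, abs_mul, abs_of_pos hE]
          ring_nf
      _ ≤ η := weight ((mul_le_mul_of_nonneg_left h012 hx).trans_eq
          (by ring : _ = (1 + l) ^ 2 * x * d)) (by nlinarith)

theorem tendsto_one_add_mul_exp_neg_mul (hl : 0 < l) :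
    Tendsto (fun x : ℝ≥0 => (1 + (x : ℝ)) * Real.exp (-(l * x))) atTop (𝓝 0) := by
  simpa [add_mul] using (tendsto_exp_neg_mul hl).add (tendsto_pow_mul_exp_neg_mul hl 1)

theorem exists_cutoff_isBesselClose (hl : 0 < l) (hη : 0 < η) :
    ∃ χ, ContDiff ℝ ∞ χ ∧ HasCompactSupport χ ∧
      IsBesselClose η (fun x => Real.exp (-(l * x))) fun x => Real.exp (-(l * x)) * χ x := by
  obtain ⟨C, χ₁, hχ₁⟩ := exists_isCutoff_one
  have htail := (((tendsto_one_add_mul_exp_neg_mul hl).const_mul ((1 + l) ^ 2)).mul_const C)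
  rw [mul_zero, zero_mul] at htail
  obtain ⟨R, hR⟩ := eventually_atTop.1 (htail.eventually (ge_mem_nhds hη))
  have hχ := hχ₁.scale (le_max_left 1 (R : ℝ))
  refine ⟨_, hχ.contDiff, hχ.hasCompactSupport,
    isBesselClose_exp_mul hl (contDiff_infty.1 hχ.contDiff 2) fun x => ?_⟩
  rcases lt_or_ge (x : ℝ) (max 1 (R : ℝ)) with hx | hx
  · have hone := hχ.eventuallyEq_one x (by rwa [abs_of_nonneg x.coe_nonneg])
    exact ⟨0, by simp [hone.eq_of_nhds], by simp [hone.deriv_eq], by simp [hone.deriv.deriv_eq],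
      by simpa using hη.le⟩
  · obtain ⟨h0, h1, h2⟩ := hχ.bound x
    have htail := hR x (NNReal.coe_le_coe.1 ((le_max_right 1 (R : ℝ)).trans hx))
    exact ⟨C, h0, h1, h2, by simpa only [mul_assoc] using htail⟩

variable {T : ℝ≥0 → C₀(ℝ≥0, ℝ) →L[ℝ] C₀(ℝ≥0, ℝ)}

theorem IsSquaredBesselSemigroup.hasGenerator_expDecay (hT : IsSquaredBesselSemigroup β T)
    (hl : 0 < l) : HasGenerator T (expDecay l) (besselGenerator β expDecay l) := by
  refine (isBesselPair_exp β hl).hasGenerator_of_close hT.feller.isContractionSemigroup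
    fun η hη => ?_
  obtain ⟨χ, hχ, hs, hclose⟩ := exists_cutoff_isBesselClose hl hη
  have hF : ContDiff ℝ ∞ fun x => Real.exp (-(l * x)) * χ x := by fun_prop
  have hFs : HasCompactSupport fun x => Real.exp (-(l * x)) * χ x := hs.mul_left
  obtain ⟨f, g, hfg⟩ := exists_isBesselPair β hF hFs
  exact ⟨_, f, g, (generatorMapsTo_iff hfg.image_eq).1 (hT.generator _ f hF hFs hfg.apply_eq),
    hfg, hclose⟩

theorem IsSquaredBesselSemigroup.eq_besselFlow (hβ : 0 ≤ β) (hT : IsSquaredBesselSemigroup β T) :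
    T = besselFlow hβ :=
  (followsBesselFlow_besselFlow hβ).eq_of_hasGenerator isExponentialFamily_expDecay
    (isFellerSemigroup_besselFlow hβ).isContractionSemigroup hT.feller.isContractionSemigroup
    fun _ hl => hT.hasGenerator_expDecay hl

theorem squaredBessel_eq_besselFlow (hβ : 0 ≤ β) : squaredBessel β = besselFlow hβ := by
  have hex : ∃! T, IsSquaredBesselSemigroup β T :=
    ⟨_, isSquaredBesselSemigroup_besselFlow hβ, fun _ hT => hT.eq_besselFlow hβ⟩
  rw [squaredBessel, dif_pos hex]
  exact hex.choose_spec.1.eq_besselFlow hβ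

end BesselUniqueness

/-! ### The Laguerre semigroups -/

section Laguerre

variable {β w : ℝ}

theorem exp_neg_mem_Ioc (t : ℝ≥0) : Real.exp (-t) ∈ Set.Ioc 0 1 :=
  ⟨Real.exp_pos _, Real.exp_le_one_iff.2 (neg_nonpos.2 t.2)⟩

theorem coe_toNNReal_exp_sub_one (t : ℝ≥0) :
    ((Real.exp t - 1).toNNReal : ℝ) = Real.exp t - 1 :=
  Real.coe_toNNReal _ (sub_nonneg.2 (Real.one_le_exp t.2))

theorem discreteLaguerre_eq (hβ : 0 ≤ β) (t : ℝ≥0) :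
    discreteLaguerre β t = (linearBirthDeath hβ (Real.exp t - 1).toNNReal).comp
      (discreteDilation (Real.exp (-t)) (exp_neg_mem_Ioc t).1 (exp_neg_mem_Ioc t).2) := by
  rw [discreteLaguerre, discreteBessel_eq_linearBirthDeath hβ]

theorem isPositiveContraction_discreteLaguerre (hβ : 0 ≤ β) (t : ℝ≥0) :
    IsPositiveContraction (discreteLaguerre β t) := by
  rw [discreteLaguerre_eq hβ]
  exact (isPositiveContraction_linearBirthDeath hβ _).comp (isPositiveContraction_kernelOperator _)

theorem discreteLaguerre_geom_eq_linearBirthDeath (hβ : 0 ≤ β) (t : ℝ≥0) (hw : w ∈ Set.Ioo 0 1) :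
    discreteLaguerre β t (geom w)
      = linearBirthDeath hβ (Real.exp t - 1).toNNReal (geom (Real.exp (-t) * w)) := by
  rw [discreteLaguerre_eq hβ, ContinuousLinearMap.comp_apply, discreteDilation_geom _ _ hw]

theorem discreteLaguerre_geom (hβ : 0 ≤ β) (t : ℝ≥0) (hw : w ∈ Set.Ioo 0 1) :
    discreteLaguerre β t (geom w) = (1 + (1 - Real.exp (-t)) * w) ^ (-β) •
      geom (Real.exp (-t) * w / (1 + (1 - Real.exp (-t)) * w)) := by
  have hden : 1 + (Real.exp t - 1) * (Real.exp (-t) * w) = 1 + (1 - Real.exp (-t)) * w := by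
    rw [Real.exp_neg]
    field_simp
  rw [discreteLaguerre_geom_eq_linearBirthDeath hβ t hw, followsBesselFlow_linearBirthDeath hβ _ _
    (mul_mem_Ioo (exp_neg_mem_Ioc t) hw), coe_toNNReal_exp_sub_one, hden]

theorem linearBirthDeath_comp_discreteDilation (hβ : 0 ≤ β) {σ : ℝ} (h0 : 0 < σ) (h1 : σ ≤ 1)
    {s t : ℝ≥0} (hst : (s : ℝ) = σ * t) :
    (linearBirthDeath hβ t).comp (discreteDilation σ h0 h1)
      = (discreteDilation σ h0 h1).comp (linearBirthDeath hβ s) := by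
  lift σ to ℝ≥0 using h0.le
  obtain rfl : s = σ * t := NNReal.eq hst
  exact (followsBesselFlow_linearBirthDeath hβ).comp_eq (followsBesselFlow_linearBirthDeath hβ)
    isExponentialFamily_geom (fun _ hw => mul_mem_Ioo ⟨h0, h1⟩ hw)
    (fun _ hw => discreteDilation_geom h0 h1 hw) t

theorem discreteLaguerre_add (hβ : 0 ≤ β) (s t : ℝ≥0) :
    discreteLaguerre β (s + t) = (discreteLaguerre β s).comp (discreteLaguerre β t) := by
  set r : ℝ≥0 := (Real.exp s).toNNReal * (Real.exp t - 1).toNNReal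
  have hr : (r : ℝ) = Real.exp s * (Real.exp t - 1) := by
    rw [NNReal.coe_mul, coe_toNNReal_exp_sub_one, Real.coe_toNNReal _ (Real.exp_pos _).le]
  have hscale := linearBirthDeath_comp_discreteDilation hβ (exp_neg_mem_Ioc s).1
    (exp_neg_mem_Ioc s).2 (s := (Real.exp t - 1).toNNReal) (t := r) (by
      rw [hr, coe_toNNReal_exp_sub_one, ← mul_assoc, ← Real.exp_add, neg_add_cancel, Real.exp_zero,
        one_mul])
  have htime : (Real.exp (s + t : ℝ≥0) - 1).toNNReal = (Real.exp s - 1).toNNReal + r := by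
    refine NNReal.eq ?_
    rw [coe_toNNReal_exp_sub_one, NNReal.coe_add, NNReal.coe_add, Real.exp_add, hr,
      coe_toNNReal_exp_sub_one]
    ring
  refine isExponentialFamily_geom.ext fun w hw => ?_
  have hw' := mul_mem_Ioo (exp_neg_mem_Ioc t) hw
  calc discreteLaguerre β (s + t) (geom w)
      = linearBirthDeath hβ ((Real.exp s - 1).toNNReal + r)
          (geom (Real.exp (-s) * (Real.exp (-t) * w))) := by
        rw [discreteLaguerre_geom_eq_linearBirthDeath hβ _ hw, htime, NNReal.coe_add, neg_add,
          Real.exp_add, mul_assoc]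
    _ = linearBirthDeath hβ (Real.exp s - 1).toNNReal (linearBirthDeath hβ r
          (discreteDilation (Real.exp (-s)) (exp_neg_mem_Ioc s).1 (exp_neg_mem_Ioc s).2
            (geom (Real.exp (-t) * w)))) := by
        rw [discreteDilation_geom _ _ hw', (followsBesselFlow_linearBirthDeath hβ).add_apply
          isExponentialFamily_geom _ _ (mul_mem_Ioo (exp_neg_mem_Ioc s) hw')]
    _ = discreteLaguerre β s (linearBirthDeath hβ (Real.exp t - 1).toNNReal
          (geom (Real.exp (-t) * w))) := by
        rw [← ContinuousLinearMap.comp_apply (linearBirthDeath hβ r), hscale,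
          discreteLaguerre_eq hβ s]
        rfl
    _ = discreteLaguerre β s (discreteLaguerre β t (geom w)) := by
        rw [discreteLaguerre_geom_eq_linearBirthDeath hβ t hw]

theorem hasGenerator_discreteLaguerre_geom (hβ : 0 ≤ β) (hw : w ∈ Set.Ioo 0 1) :
    HasGenerator (discreteLaguerre β) (geom w)
      ((-(β * w)) • geom w + (-(w * (1 + w))) • deriv geom w) := by
  have hexp : HasDerivAt (fun t : ℝ => Real.exp (-t)) (-1) 0 := by
    simpa using (hasDerivAt_id' (0 : ℝ)).fun_neg.exp
  have hden : HasDerivAt (fun t : ℝ => 1 + (1 - Real.exp (-t)) * w) w 0 := by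
    simpa using ((hexp.const_sub 1).mul_const w).const_add 1
  have ha : HasDerivAt (fun t : ℝ => (1 + (1 - Real.exp (-t)) * w) ^ (-β)) (-(β * w)) 0 := by
    simpa [mul_comm] using hden.rpow_const (p := -β) (by simp)
  have hφ : HasDerivAt (fun t : ℝ => Real.exp (-t) * w / (1 + (1 - Real.exp (-t)) * w))
      (-(w * (1 + w))) 0 := by
    refine ((hexp.mul_const w).fun_div hden (by simp)).congr_deriv ?_
    simp
    ring
  exact hasGenerator_of_flow (fun t => discreteLaguerre_geom hβ t hw) rfl ha (by simp) hφ (by simp)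
    (isExponentialFamily_geom.differentiableAt w hw).hasDerivAt

theorem isFellerSemigroup_discreteLaguerre (hβ : 0 ≤ β) :
    IsFellerSemigroup (discreteLaguerre β) := by
  refine isExponentialFamily_geom.isFellerSemigroup (isPositiveContraction_discreteLaguerre hβ)
    (fun w hw => by simp [discreteLaguerre_geom hβ 0 hw]) (discreteLaguerre_add hβ) (fun t n => ?_)
    fun w hw => ⟨_, hasGenerator_discreteLaguerre_geom hβ hw⟩
  have hlim : Tendsto (fun w => Real.exp (-t) * w) (𝓝[>] 0) (𝓝[>] 0) := by
    refine tendsto_nhdsWithin_iff.2 ⟨?_, ?_⟩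
    · exact ((continuous_const_mul _).tendsto' 0 0 (mul_zero _)).mono_left nhdsWithin_le_nhds
    · filter_upwards [self_mem_nhdsWithin] with w hw using mul_pos (Real.exp_pos _) hw
  refine (((followsBesselFlow_linearBirthDeath hβ).tendsto_apply_one isExponentialFamily_geom
    (Real.exp t - 1).toNNReal n).comp hlim).congr' ?_
  filter_upwards [isExponentialFamily_geom.mem_nhdsGT] with w hw
  rw [discreteLaguerre_geom_eq_linearBirthDeath hβ t hw, Function.comp_apply]

theorem isBirthDeathSemigroup_discreteLaguerre (hβ : 0 ≤ β) :
    IsBirthDeathSemigroup (fun n => n + β) (fun n => 2 * n) (discreteLaguerre β) := by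
  refine (isBirthDeathSemigroup_linear_iff hβ (κ := 2)
    (isFellerSemigroup_discreteLaguerre hβ)).2 fun w hw => ?_
  convert hasGenerator_discreteLaguerre_geom hβ hw using 6
  norm_num

theorem dilation_comp_poissonOperator {σ : ℝ} (h0 : 0 < σ) (h1 : σ ≤ 1) :
    (dilation σ.toNNReal (Real.toNNReal_pos.2 h0)).comp poissonOperator
      = poissonOperator.comp (discreteDilation σ h0 h1) := by
  refine isExponentialFamily_geom.ext fun w hw => ?_
  rw [ContinuousLinearMap.comp_apply, ContinuousLinearMap.comp_apply, poissonOperator_geom hw,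
    discreteDilation_geom _ _ hw, dilation_expDecay _ _ hw.1, Real.coe_toNNReal _ h0.le,
    poissonOperator_geom (mul_mem_Ioo ⟨h0, h1⟩ hw)]

theorem besselFlow_comp_poissonOperator (hβ : 0 ≤ β) (t : ℝ≥0) :
    (besselFlow hβ t).comp poissonOperator = poissonOperator.comp (linearBirthDeath hβ t) := by
  simpa using (followsBesselFlow_linearBirthDeath hβ).comp_eq (followsBesselFlow_besselFlow hβ)
    isExponentialFamily_geom (κ := 1) (fun w hw => by simpa using hw.1)
    (fun w hw => by simpa using poissonOperator_geom hw) t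

theorem continuousLaguerre_comp_poissonOperator (hβ : 0 ≤ β) (t : ℝ≥0) :
    (continuousLaguerre β t).comp poissonOperator
      = poissonOperator.comp (discreteLaguerre β t) := by
  rw [continuousLaguerre, discreteLaguerre_eq hβ, squaredBessel_eq_besselFlow hβ,
    ContinuousLinearMap.comp_assoc,
    dilation_comp_poissonOperator (exp_neg_mem_Ioc t).1 (exp_neg_mem_Ioc t).2,
    ← ContinuousLinearMap.comp_assoc, besselFlow_comp_poissonOperator,
    ContinuousLinearMap.comp_assoc]

end Laguerre

end Gateway

end

theorem theorem2 (β : ℝ) (hβ : 0 ≤ β) :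
    Gateway.IsBirthDeathSemigroup (fun n : ℕ => (n : ℝ) + β) (fun n : ℕ => 2 * (n : ℝ))
        (Gateway.discreteLaguerre β) ∧
      ∀ t : NNReal,
        (Gateway.continuousLaguerre β t).comp Gateway.poissonOperator
          = Gateway.poissonOperator.comp (Gateway.discreteLaguerre β t) :=
  ⟨Gateway.isBirthDeathSemigroup_discreteLaguerre hβ,
    Gateway.continuousLaguerre_comp_poissonOperator hβ⟩
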